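/- Let $\lambda>0$ and $\sigma>0$, let $(\tau_i)_{i}$ be the points of a homogeneous Poisson point process of intensity $\lambda$ on $\mathbb{R}$, and let \[ X(t)=\sum_i g_\sigma(t-\tau_i),\qquad g_\sigma(t)=\frac{1}{\sigma\sqrt{2\pi}}\,e^{-t^2/(2\sigma^2)},\qquad t\in\mathbb{R}. \] (Almost surely the series converges for every $t$ and $X$ is twice continuously differentiable on $\mathbb{R}$.) For a process $Y$ and $\alpha\in\mathbb{R}$ put $N_Y(\alpha,[0,1])=\#\{t\in[0,1]: Y(t)=\alpha\}$ and $C_Y(\alpha,[0,1])=\mathbb{E}\,N_Y(\alpha,[0,1])$, and let $\rho(\lambda,\sigma)$ be the expected number of points $t\in[0,1]$ at which $X:\mathbb{R}\to\mathbb{R}$ has a local extremum; these counts are random variables (up to null sets). Then \[ \mathbb{P}\bigl(\exists\, t\in[0,1]:\ X'(t)=0 \text{ and } X''(t)=0\bigr)=0, \] almost surely the local extrema of $X$ in $[0,1]$ are exactly the points of $[0,1]$ where $X'$ vanishes, and hence $\rho(\lambda,\sigma)=\mathbb{E}\,N_{X'}(0,[0,1])$. Moreover, for every $\alpha\in\mathbb{R}$,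 \[ C_X(\alpha,[0,1])\ \le\ \rho(\lambda,\sigma)\ \le\ \bigl(3\lambda(2+2\sigma)+1\bigr)e^{\lambda}. \] -/

import Mathlib

open MeasureTheory ProbabilityTheory Set
open scoped NNReal ENNReal

noncomputable section

namespace ShotNoise

/-- The number of points of the random sequence `τ` lying in `B`, counted with multiplicity. -/
def pointCount {Ω : Type*} (τ : ℕ → Ω → ℝ) (B : Set ℝ) (ω : Ω) : ℕ∞ :=
  Set.encard {i : ℕ | τ i ω ∈ B}

/-- The random variables `τ i` enumerate the points of a homogeneous Poisson point process on the
real line with intensity `lam`: the number of points in a Borel set `B` of finite Lebesgue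
measure is Poisson distributed with parameter `lam * |B|`, and the numbers of points in finitely
many pairwise disjoint Borel sets are independent. -/
structure IsPoissonProcess {Ω : Type*} [MeasurableSpace Ω] (μ : Measure Ω) (lam : ℝ)
    (τ : ℕ → Ω → ℝ) : Prop where
  measurable_point : ∀ i, Measurable (τ i)
  law_count : ∀ B : Set ℝ, MeasurableSet B → volume B ≠ ∞ →
    HasLaw (pointCount τ B)
      ((poissonMeasure (lam * volume.real B).toNNReal).map (fun k : ℕ => (k : ℕ∞))) μ
  indep_count : ∀ (n : ℕ) (B : Fin n → Set ℝ), (∀ j, MeasurableSet (B j)) →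
    Pairwise (fun j k => Disjoint (B j) (B k)) →
    iIndepFun (fun j => pointCount τ (B j)) μ

/-- The Gaussian kernel of width `σ`. -/
def gaussianKernel (σ t : ℝ) : ℝ :=
  1 / (σ * Real.sqrt (2 * Real.pi)) * Real.exp (-t ^ 2 / (2 * σ ^ 2))

/-- The sample path `t ↦ ∑ i, g_σ (t - τ i)` of the shot noise process. -/
def shotNoise {Ω : Type*} (σ : ℝ) (τ : ℕ → Ω → ℝ) (ω : Ω) (t : ℝ) : ℝ :=
  ∑' i, gaussianKernel σ (t - τ i ω)

/-- The multiplicity function `N_f(α, [a, b])`: the number of `t ∈ [a, b]` with `f t = α`. -/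
def crossingCount (f : ℝ → ℝ) (α a b : ℝ) : ℕ∞ :=
  Set.encard {t : ℝ | t ∈ Icc a b ∧ f t = α}

/-- The number of points of `[a, b]` at which `f : ℝ → ℝ` has a local extremum
(relative to the whole line). -/
def localExtrCount (f : ℝ → ℝ) (a b : ℝ) : ℕ∞ :=
  Set.encard {t : ℝ | t ∈ Icc a b ∧ IsLocalExtr f t}

/-- The mean number of crossings `C_Y(α, [a, b])` of the level `α` by the process `Y`. -/
def meanCrossings {Ω : Type*} [MeasurableSpace Ω] (μ : Measure Ω) (Y : Ω → ℝ → ℝ)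
    (α a b : ℝ) : ℝ≥0∞ :=
  ∫⁻ ω, (crossingCount (Y ω) α a b : ℝ≥0∞) ∂μ

/-- The mean number of local extrema of the process `Y` in `[a, b]`. -/
def meanLocalExtr {Ω : Type*} [MeasurableSpace Ω] (μ : Measure Ω) (Y : Ω → ℝ → ℝ)
    (a b : ℝ) : ℝ≥0∞ :=
  ∫⁻ ω, (localExtrCount (Y ω) a b : ℝ≥0∞) ∂μ

end ShotNoise

end

/-! Write `φ` for the derivative of the Gaussian kernel. The bound on the mean number of zeros of
`X'` rests on adding one point at a time. Fix an integer `R > 1 + σ` and the window `W = [-R, R)`;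
let `p n` be the probability that `W` contains `n` points and `a n c` the mean number of solutions
of `X' = c` in `[0, 1]` on that event. The size-bias identity
`IsPoissonProcess.lintegral_natCount_mul` turns `(n + 1) * a (n + 1) c` into `λ` times the integral
over `x ∈ W` of the mean number of crossings of `X' + φ(· - x)` when `W` holds `n` points.

For a fixed continuous `f`, `lintegral_crossingCount_translate_le` bounds the integral of the
crossings of `f + φ(· - x)` over `x` by `3` plus the integral of the crossings of `f + φ u` over the
possible values `u = t - x`. The `3` is the number of monotone branches of `φ`. Since `f + φ u`
crosses `c` where `f` crosses `c - φ u`, this closes the recursion `(n + 1) a (n + 1) c ≤ λ (3 p n +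
∫ a n (c - φ u) du)` over `u ∈ [-R, R + 1]`. With no point in `W`, `X'` is strictly increasing on
`[0, 1]`, so `a 0 c ≤ p 0`. Induction and summation over `n` give the mean bound `4 e ^ λ - 3`, free
of `R`, and `(1 - λ) e ^ λ ≤ 1` makes it smaller than the stated one.

The same identity, applied to the event of a multiple zero of `X'`, reduces `ae_no_multiple_zero` to
a Sard argument: for almost every path, the positions `x` at which the extra kernel creates a
tangency form a null set. The second derivative test then identifies extrema with zeros of `X'`.

Finally, Rolle's theorem on `[0, n]` loses a single crossing, whereas by stationarity both means
grow linearly in `n`; dividing by `n` gives `lintegral_crossingCount_path_le`. The size-bias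
identity and stationarity are both obtained from the independent Poisson counts of dyadic cells.
Crossing counts are measurable because they are suprema of dyadic counts, themselves functions of
the values at rational times. -/

noncomputable section

namespace ShotNoise

/-! ### Counting points through dyadic partitions -/

/-- The index of the dyadic interval of length `2⁻ᵐ` containing `t`. -/
def dyadicIndex (m : ℕ) (t : ℝ) : ℕ := ⌊2 ^ m * t⌋₊

lemma dyadicIndex_succ_div_two (m : ℕ) (t : ℝ) :
    dyadicIndex (m + 1) t / 2 = dyadicIndex m t := by
  unfold dyadicIndex
  have h := Nat.floor_div_natCast ((2 : ℝ) ^ (m + 1) * t) 2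
  rw [← h]
  congr 1
  push_cast
  ring

lemma encard_image_dyadicIndex_mono (A : Set ℝ) :
    Monotone fun m => (dyadicIndex m '' A).encard := by
  refine monotone_nat_of_le_succ fun m => ?_
  have : dyadicIndex m '' A = (· / 2) '' (dyadicIndex (m + 1) '' A) := by
    rw [image_image]
    simp [dyadicIndex_succ_div_two]
  rw [this]
  exact encard_image_le _ _

lemma eventually_dyadicIndex_ne {s t : ℝ} (hs : 0 ≤ s) (hst : s < t) :
    ∀ᶠ m in Filter.atTop, dyadicIndex m s ≠ dyadicIndex m t := by
  have h : Filter.Tendsto (fun m : ℕ => (2 : ℝ) ^ m * (t - s)) Filter.atTop Filter.atTop :=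
    (tendsto_pow_atTop_atTop_of_one_lt (by norm_num)).atTop_mul_const (by linarith)
  filter_upwards [h.eventually_ge_atTop 1] with m hm heq
  unfold dyadicIndex at heq
  have h1 := Nat.lt_floor_add_one ((2 : ℝ) ^ m * t)
  have h2 := Nat.floor_le (show 0 ≤ (2 : ℝ) ^ m * s by positivity)
  have h3 : ((⌊(2 : ℝ) ^ m * s⌋₊ : ℕ) : ℝ) = ⌊(2 : ℝ) ^ m * t⌋₊ := by rw [heq]
  nlinarith

/-- Finitely many distinct points are eventually separated by the dyadic partition; testing on
finite subsets covers infinite `A` as well. Nonnegativity matters because the natural floor sends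
all negative numbers to `0`. -/
lemma encard_eq_iSup_dyadic {A : Set ℝ} (hA : ∀ t ∈ A, 0 ≤ t) :
    A.encard = ⨆ m, (dyadicIndex m '' A).encard := by
  refine le_antisymm ?_ (iSup_le fun m => encard_image_le _ _)
  refine ENat.forall_natCast_le_iff_le.1 fun n hn => ?_
  obtain ⟨s, hsA, hs⟩ := exists_subset_encard_eq hn
  have hfin : s.Finite := finite_of_encard_eq_coe hs
  have key : ∀ᶠ m in Filter.atTop, InjOn (dyadicIndex m) s := by
    have : ∀ᶠ m in Filter.atTop, ∀ x ∈ s, ∀ y ∈ s, x < y →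
        dyadicIndex m x ≠ dyadicIndex m y := by
      rw [Filter.eventually_all_finite hfin]
      intro x hx
      rw [Filter.eventually_all_finite hfin]
      intro y hy
      by_cases hxy : x < y
      · filter_upwards [eventually_dyadicIndex_ne (hA x (hsA hx)) hxy] with m hm _ using hm
      · exact Filter.Eventually.of_forall fun _ h => absurd h hxy
    filter_upwards [this] with m hm x hx y hy hxy
    rcases lt_trichotomy x y with h | h | h
    · exact absurd hxy (hm x hx y hy h)
    · exact h
    · exact absurd hxy.symm (hm y hy x hx h)
  obtain ⟨m, hm⟩ := key.exists
  calc (n : ℕ∞) = s.encard := hs.symm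
    _ = (dyadicIndex m '' s).encard := hm.encard_image.symm
    _ ≤ (dyadicIndex m '' A).encard := encard_le_encard (image_mono hsA)
    _ ≤ _ := le_iSup (fun m => (dyadicIndex m '' A).encard) m

lemma dyadicIndex_lt {m : ℕ} {t : ℝ} (ht : t ≤ 1) : dyadicIndex m t < 2 ^ m + 1 := by
  rw [Nat.lt_add_one_iff]
  refine Nat.floor_le_of_le ?_
  push_cast
  have : (0 : ℝ) < 2 ^ m := by positivity
  nlinarith

-- The range has `2 ^ m + 1` indices, one more than the number of cells of `[0, 1)`: the point `t =
-- 1` has index `2 ^ m`.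
open Classical in
lemma encard_image_dyadicIndex_eq_sum {A : Set ℝ} (hA : ∀ t ∈ A, t ≤ 1) (m : ℕ) :
    (dyadicIndex m '' A).encard =
      ∑ k ∈ Finset.range (2 ^ m + 1), if ∃ t ∈ A, dyadicIndex m t = k then (1 : ℕ∞) else 0 := by
  rw [Finset.sum_boole, ← encard_coe_eq_coe_finsetCard]
  congr 1
  ext k
  simp only [mem_image, Finset.coe_filter, Finset.mem_range, mem_ofPred_eq]
  constructor
  · rintro ⟨t, ht, rfl⟩
    exact ⟨dyadicIndex_lt (hA t ht), t, ht, rfl⟩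
  · rintro ⟨-, h⟩
    exact h

lemma dyadicIndex_eq_iff {m k : ℕ} {t : ℝ} (ht : 0 ≤ t) :
    dyadicIndex m t = k ↔ (k : ℝ) / 2 ^ m ≤ t ∧ t < (k + 1) / 2 ^ m := by
  unfold dyadicIndex
  rw [Nat.floor_eq_iff (by positivity), div_le_iff₀ (by positivity), lt_div_iff₀ (by positivity),
    mul_comm t]

/-! ### Crossing counts as functionals of the values at rational points -/

/-- A continuous function vanishes somewhere on `[a, d]` if and only if it takes arbitrarily small
values at the rational points of `[a, d]`. -/
lemma exists_zero_Icc_iff_rat {r : ℝ → ℝ} (hr : Continuous r) (a d : ℚ) :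
    (∃ t ∈ Icc (a : ℝ) d, r t = 0) ↔
      ∀ n : ℕ, ∃ q : ℚ, a ≤ q ∧ q ≤ d ∧ |r q| < 1 / ((n : ℝ) + 1) := by
  constructor
  · rintro ⟨t, ⟨hat, htd⟩, ht⟩ n
    have hpos : (0 : ℝ) < 1 / ((n : ℝ) + 1) := by positivity
    have hopen : IsOpen {s | |r s| < 1 / ((n : ℝ) + 1)} :=
      isOpen_lt (by fun_prop) continuous_const
    have hmem : t ∈ {s | |r s| < 1 / ((n : ℝ) + 1)} := by simp [ht]; positivity
    obtain ⟨ε, hε, hball⟩ := Metric.isOpen_iff.1 hopen t hmem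
    -- A zero at the left endpoint may have no rational of the interval just below it; there the
    -- rational endpoint itself serves.
    rcases eq_or_lt_of_le hat with rfl | hat'
    · exact ⟨a, le_rfl, by exact_mod_cast htd, hmem⟩
    · obtain ⟨q, hq1, hq2⟩ := exists_rat_btwn (show max (a : ℝ) (t - ε) < t by simp [hat', hε])
      refine ⟨q, ?_, ?_, ?_⟩
      · exact_mod_cast ((le_max_left _ _).trans hq1.le)
      · exact_mod_cast (hq2.le.trans htd)
      · apply hball
        rw [Metric.mem_ball, Real.dist_eq, abs_lt]
        have := (le_max_right (a : ℝ) (t - ε)).trans_lt hq1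
        constructor <;> linarith
  · intro h
    obtain ⟨q₀, hq₀, hq₀', -⟩ := h 0
    have hne : (Icc (a : ℝ) d).Nonempty := ⟨q₀, by exact_mod_cast hq₀, by exact_mod_cast hq₀'⟩
    obtain ⟨t, ht, hmin⟩ := isCompact_Icc.exists_isMinOn hne (f := fun s => |r s|)
      (by fun_prop)
    refine ⟨t, ht, ?_⟩
    by_contra hne
    obtain ⟨n, hn⟩ := exists_nat_one_div_lt (abs_pos.2 hne)
    obtain ⟨q, hq, hq', hqn⟩ := h n
    have := hmin (show (q : ℝ) ∈ Icc (a : ℝ) d from ⟨by exact_mod_cast hq, by exact_mod_cast hq'⟩)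
    simp only [mem_ofPred_eq] at this
    linarith

/-- The family `y` indexed by the rationals comes arbitrarily close to the level `c` on a
closed subinterval of `{t ∈ [0, 1] | dyadicIndex m t = k}`. -/
def RatHits (c : ℝ) (m k : ℕ) (y : ℚ → ℝ) : Prop :=
  ∃ d : ℚ, d ≤ 1 ∧ d < ((k : ℚ) + 1) / 2 ^ m ∧
    ∀ n : ℕ, ∃ q : ℚ, (k : ℚ) / 2 ^ m ≤ q ∧ q ≤ d ∧ |y q - c| < 1 / ((n : ℝ) + 1)

/-- A dyadic cell is half-open, so compactness is applied on closed subintervals ending at a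
rational `d` inside the cell; `d = 1` handles a crossing at time `1`. -/
lemma ratHits_iff {z : ℝ → ℝ} (hz : Continuous z) (c : ℝ) (m k : ℕ) :
    RatHits c m k (fun q => z q) ↔
      ∃ t ∈ {t : ℝ | t ∈ Icc (0 : ℝ) 1 ∧ z t = c}, dyadicIndex m t = k := by
  have key := fun d : ℚ => exists_zero_Icc_iff_rat (r := fun t => z t - c) (by fun_prop)
    ((k : ℚ) / 2 ^ m) d
  have hcast : ∀ d : ℚ, d < ((k : ℚ) + 1) / 2 ^ m ↔ (d : ℝ) < (k + 1) / 2 ^ m := fun d => by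
    rw [← Rat.cast_lt (K := ℝ)]
    push_cast
    rfl
  unfold RatHits
  simp only [← key, hcast]
  push_cast
  constructor
  · rintro ⟨d, hd1, hdk, t, ⟨ht1, ht2⟩, htc⟩
    have hd1' : (d : ℝ) ≤ 1 := by exact_mod_cast hd1
    have ht0 : 0 ≤ t := le_trans (by positivity) ht1
    exact ⟨t, ⟨⟨ht0, ht2.trans hd1'⟩, by linarith⟩,
      (dyadicIndex_eq_iff ht0).2 ⟨ht1, ht2.trans_lt hdk⟩⟩
  · rintro ⟨t, ⟨⟨ht0, ht1⟩, htc⟩, htk⟩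
    obtain ⟨h1, h2⟩ := (dyadicIndex_eq_iff ht0).1 htk
    rcases eq_or_lt_of_le ht1 with rfl | ht1'
    · refine ⟨1, le_rfl, by simpa using h2, 1, ⟨h1, by simp⟩, by linarith⟩
    · obtain ⟨d, hd, hd'⟩ := exists_rat_btwn (lt_min ht1' h2)
      have hd1 := hd'.trans_le (min_le_left _ _)
      have hd2 := hd'.trans_le (min_le_right _ _)
      exact ⟨d, by exact_mod_cast hd1.le, hd2, t, ⟨h1, hd.le⟩, by linarith⟩

lemma measurableSet_ratHits (c : ℝ) (m k : ℕ) : MeasurableSet {y | RatHits c m k y} := by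
  unfold RatHits
  simp only [measurableSet_setOfPred]
  refine Measurable.exists fun d => ?_
  refine Measurable.and measurable_const (Measurable.and measurable_const ?_)
  refine Measurable.forall fun n => Measurable.exists fun q => ?_
  refine Measurable.and measurable_const (Measurable.and measurable_const ?_)
  rw [← measurableSet_setOfPred]
  exact measurableSet_lt (by fun_prop) measurable_const

lemma measurable_enat_iff {α : Type*} [MeasurableSpace α] {f : α → ℕ∞} :
    Measurable f ↔ Measurable fun a => (f a : ℝ≥0∞) := by
  constructor
  · exact fun h => (measurable_of_countable _).comp h
  · intro h
    refine ENat.measurable_iff.2 fun n => ?_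
    have : f ⁻¹' {(n : ℕ∞)} = (fun a => (f a : ℝ≥0∞)) ⁻¹' {(n : ℝ≥0∞)} := by
      ext a
      simp only [mem_preimage, mem_singleton_iff]
      rw [← ENat.toENNReal_coe, ENat.toENNReal_inj]
    rw [this]
    exact h (measurableSet_singleton _)

open Classical in
/-- The number of dyadic intervals of order `m` on which `y` hits the level `c`. -/
def ratCountAux (c : ℝ) (m : ℕ) (y : ℚ → ℝ) : ℕ∞ :=
  ∑ k ∈ Finset.range (2 ^ m + 1), if RatHits c m k y then 1 else 0

/-- The number of crossings of the level `c` in `[0, 1]`, as a function of the values at rational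
points. -/
def ratCount (c : ℝ) (y : ℚ → ℝ) : ℕ∞ := ⨆ m, ratCountAux c m y

lemma measurable_ratCountAux (c : ℝ) (m : ℕ) : Measurable (ratCountAux c m) := by
  unfold ratCountAux
  refine Finset.measurable_fun_sum _ fun k _ => ?_
  exact Measurable.ite (measurableSet_ratHits c m k) measurable_const measurable_const

lemma measurable_ratCount (c : ℝ) : Measurable (ratCount c) := by
  rw [measurable_enat_iff]
  simp only [ratCount, ENat.toENNReal_iSup]
  exact Measurable.iSup fun m => measurable_enat_iff.1 (measurable_ratCountAux c m)

lemma ratCountAux_eq {z : ℝ → ℝ} (hz : Continuous z) (c : ℝ) (m : ℕ) :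
    ratCountAux c m (fun q => z q) =
      (dyadicIndex m '' {t : ℝ | t ∈ Icc (0 : ℝ) 1 ∧ z t = c}).encard := by
  classical
  rw [encard_image_dyadicIndex_eq_sum (fun t ht => ht.1.2)]
  unfold ratCountAux
  simp only [ratHits_iff hz]

lemma ratCount_eq {z : ℝ → ℝ} (hz : Continuous z) (c : ℝ) :
    ratCount c (fun q => z q) = crossingCount z c 0 1 := by
  unfold ratCount crossingCount
  rw [encard_eq_iSup_dyadic (fun t ht => ht.1.1)]
  simp only [ratCountAux_eq hz]

end ShotNoise

end

noncomputable section

namespace ShotNoise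

/-! ### The mean number of crossings when a kernel is added at a uniform random position -/

/-- For nonempty intervals, the difference set lies in an interval whose length is the sum of the
two lengths. This is where convexity of the level sets on each branch pays off. -/
lemma volume_difference_le {P Q : Set ℝ} (hP : P.OrdConnected) (hQ : Q.OrdConnected)
    (hPb : Bornology.IsBounded P) (hQb : Bornology.IsBounded Q) :
    volume {x : ℝ | ∃ t ∈ P, ∃ u ∈ Q, x = t - u} ≤ volume P + volume Q := by
  rcases P.eq_empty_or_nonempty with rfl | hPn
  · simp
  rcases Q.eq_empty_or_nonempty with rfl | hQn
  · simp
  have aux : ∀ {S : Set ℝ}, S.OrdConnected → Bornology.IsBounded S → S.Nonempty →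
      ENNReal.ofReal (sSup S - sInf S) ≤ volume S := by
    intro S hS hSb hSn
    rw [← Real.volume_Ioo]
    exact measure_mono
      (IsConnected.Ioo_csInf_csSup_subset ⟨hSn, hS.isPreconnected⟩ hSb.bddBelow hSb.bddAbove)
  have h0 : ∀ {S : Set ℝ}, Bornology.IsBounded S → S.Nonempty → 0 ≤ sSup S - sInf S :=
    fun hSb hSn => sub_nonneg.2 (csInf_le_csSup hSn hSb.bddBelow hSb.bddAbove)
  have hsub : {x : ℝ | ∃ t ∈ P, ∃ u ∈ Q, x = t - u} ⊆ Icc (sInf P - sSup Q) (sSup P - sInf Q) := by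
    rintro x ⟨t, ht, u, hu, rfl⟩
    exact ⟨sub_le_sub (csInf_le hPb.bddBelow ht) (le_csSup hQb.bddAbove hu),
      sub_le_sub (le_csSup hPb.bddAbove ht) (csInf_le hQb.bddBelow hu)⟩
  calc volume {x : ℝ | ∃ t ∈ P, ∃ u ∈ Q, x = t - u}
      ≤ volume (Icc (sInf P - sSup Q) (sSup P - sInf Q)) := measure_mono hsub
    _ = ENNReal.ofReal (sSup P - sInf P) + ENNReal.ofReal (sSup Q - sInf Q) := by
        rw [Real.volume_Icc, ← ENNReal.ofReal_add (h0 hPb hPn) (h0 hQb hQn)]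
        congr 1
        ring
    _ ≤ _ := add_le_add (aux hP hPb hPn) (aux hQ hQb hQn)

/-- `φ` takes intermediate values between points of `B`; satisfied by monotone and by antitone
functions. -/
def MonotoneBranch (φ : ℝ → ℝ) (B : Set ℝ) : Prop :=
  ∀ u₁ ∈ B, ∀ u₂ ∈ B, ∀ u ∈ Icc u₁ u₂, φ u ∈ uIcc (φ u₁) (φ u₂)

lemma MonotoneBranch.of_monotoneOn {φ : ℝ → ℝ} {B : Set ℝ} (hB : B.OrdConnected)
    (h : MonotoneOn φ B) : MonotoneBranch φ B := by
  intro u₁ h₁ u₂ h₂ u hu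
  have huB := hB.out h₁ h₂ hu
  exact Icc_subset_uIcc ⟨h h₁ huB hu.1, h huB h₂ hu.2⟩

lemma MonotoneBranch.of_antitoneOn {φ : ℝ → ℝ} {B : Set ℝ} (hB : B.OrdConnected)
    (h : AntitoneOn φ B) : MonotoneBranch φ B := by
  intro u₁ h₁ u₂ h₂ u hu
  have huB := hB.out h₁ h₂ hu
  exact Icc_subset_uIcc' ⟨h huB h₂ hu.2, h h₁ huB hu.1⟩

/-- By continuity `f '' P` is an interval. If `c - φ u₁` and `c - φ u₂` belong to it, so does `c - φ
u` for `u` between them, as `φ u` lies between `φ u₁` and `φ u₂`. -/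
lemma MonotoneBranch.ordConnected {φ f : ℝ → ℝ} {B V P : Set ℝ} {c : ℝ}
    (h : MonotoneBranch φ B) (hB : B.OrdConnected) (hV : V.OrdConnected) (hP : P.OrdConnected)
    (hf : Continuous f) : {u | u ∈ V ∩ B ∧ ∃ t ∈ P, f t + φ u = c}.OrdConnected := by
  have hfP : (f '' P).OrdConnected :=
    (hP.isPreconnected.image f hf.continuousOn).ordConnected
  refine ⟨?_⟩
  rintro u₁ ⟨⟨hV₁, hB₁⟩, t₁, ht₁, e₁⟩ u₂ ⟨⟨hV₂, hB₂⟩, t₂, ht₂, e₂⟩ u hu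
  refine ⟨⟨hV.out hV₁ hV₂ hu, hB.out hB₁ hB₂ hu⟩, ?_⟩
  have hφ := h u₁ hB₁ u₂ hB₂ u hu
  have hmem : c - φ u ∈ uIcc (f t₁) (f t₂) := by
    rw [mem_uIcc] at hφ ⊢
    rcases hφ with h | h
    · right; constructor <;> linarith [h.1, h.2]
    · left; constructor <;> linarith [h.1, h.2]
  obtain ⟨t, ht, e⟩ := hfP.uIcc_subset ⟨t₁, ht₁, rfl⟩ ⟨t₂, ht₂, rfl⟩ hmem
  exact ⟨t, ht, by rw [e]; ring⟩

variable {f φ : ℝ → ℝ} {σ : ℝ}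

/-- The set of positions `u` at which `f + φ u` takes the value `c` on `P`, if `φ` is monotone on
three pieces. -/
lemma measurableSet_level (hf : Continuous f) (hl : MonotoneBranch φ (Iio (-σ)))
    (hm : MonotoneBranch φ (Icc (-σ) σ)) (hr : MonotoneBranch φ (Ioi σ)) {V P : Set ℝ}
    (hV : V.OrdConnected) (hP : P.OrdConnected) (c : ℝ) :
    MeasurableSet {u | u ∈ V ∧ ∃ t ∈ P, f t + φ u = c} := by
  have : {u | u ∈ V ∧ ∃ t ∈ P, f t + φ u = c} =
      {u | u ∈ V ∩ Iio (-σ) ∧ ∃ t ∈ P, f t + φ u = c} ∪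
      {u | u ∈ V ∩ Icc (-σ) σ ∧ ∃ t ∈ P, f t + φ u = c} ∪
      {u | u ∈ V ∩ Ioi σ ∧ ∃ t ∈ P, f t + φ u = c} := by
    ext u
    simp only [mem_ofPred_eq, mem_union, mem_inter_iff, mem_Iio, mem_Icc, mem_Ioi]
    have : u < -σ ∨ (-σ ≤ u ∧ u ≤ σ) ∨ σ < u := by
      rcases lt_or_ge u (-σ) with h | h
      · exact Or.inl h
      · rcases le_or_gt u σ with h' | h'
        · exact Or.inr (Or.inl ⟨h, h'⟩)
        · exact Or.inr (Or.inr h')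
    generalize (∃ t ∈ P, f t + φ u = c) = p
    rcases this with h | h | h <;> simp [h] <;> tauto
  rw [this]
  exact ((hl.ordConnected ordConnected_Iio hV hP hf).measurableSet.union
    (hm.ordConnected ordConnected_Icc hV hP hf).measurableSet).union
    (hr.ordConnected ordConnected_Ioi hV hP hf).measurableSet

/-- A good position is `x = t - u` with `t ∈ P` and `u` in the level set. On each branch the level
set is an interval, so passing to differences costs one extra `volume P`, hence the factor `3`; the
three level sets are disjoint and their volumes add up. -/
lemma volume_translate_level_le (hf : Continuous f) (hl : MonotoneBranch φ (Iio (-σ)))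
    (hm : MonotoneBranch φ (Icc (-σ) σ)) (hr : MonotoneBranch φ (Ioi σ)) (hσ : 0 < σ)
    {W V P : Set ℝ} (hV : V.OrdConnected) (hVb : Bornology.IsBounded V) (hP : P.OrdConnected)
    (hPb : Bornology.IsBounded P) (hWV : ∀ x ∈ W, ∀ t ∈ P, t - x ∈ V) (c : ℝ) :
    volume {x | x ∈ W ∧ ∃ t ∈ P, f t + φ (t - x) = c} ≤
      3 * volume P + volume {u | u ∈ V ∧ ∃ t ∈ P, f t + φ u = c} := by
  set U : Set ℝ → Set ℝ := fun B => {u | u ∈ V ∩ B ∧ ∃ t ∈ P, f t + φ u = c} with hU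
  set D : Set ℝ → Set ℝ := fun B => {x : ℝ | ∃ t ∈ P, ∃ u ∈ U B, x = t - u} with hD
  have hUb : ∀ B, Bornology.IsBounded (U B) := fun B => hVb.subset fun u hu => hu.1.1
  have oc1 := hl.ordConnected (c := c) ordConnected_Iio hV hP hf
  have oc2 := hm.ordConnected (c := c) ordConnected_Icc hV hP hf
  have oc3 := hr.ordConnected (c := c) ordConnected_Ioi hV hP hf
  have hsub : {x | x ∈ W ∧ ∃ t ∈ P, f t + φ (t - x) = c} ⊆
      (D (Iio (-σ)) ∪ D (Icc (-σ) σ)) ∪ D (Ioi σ) := by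
    rintro x ⟨hx, t, ht, e⟩
    have hu : t - x ∈ V := hWV x hx t ht
    have e' : x = t - (t - x) := by ring
    rcases lt_or_ge (t - x) (-σ) with h | h
    · exact Or.inl (Or.inl ⟨t, ht, t - x, ⟨⟨hu, h⟩, t, ht, e⟩, e'⟩)
    · rcases le_or_gt (t - x) σ with h' | h'
      · exact Or.inl (Or.inr ⟨t, ht, t - x, ⟨⟨hu, h, h'⟩, t, ht, e⟩, e'⟩)
      · exact Or.inr ⟨t, ht, t - x, ⟨⟨hu, h'⟩, t, ht, e⟩, e'⟩
  have hdis1 : Disjoint (U (Iio (-σ))) (U (Icc (-σ) σ)) :=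
    disjoint_left.2 fun u h1 h2 => absurd h1.1.2 (not_lt.2 h2.1.2.1)
  have hdis2 : Disjoint (U (Iio (-σ)) ∪ U (Icc (-σ) σ)) (U (Ioi σ)) := by
    refine disjoint_left.2 fun u h1 h2 => ?_
    have h2' : σ < u := h2.1.2
    rcases h1 with h1 | h1
    · have : u < -σ := h1.1.2
      linarith
    · have : u ≤ σ := h1.1.2.2
      linarith
  have hUsub : (U (Iio (-σ)) ∪ U (Icc (-σ) σ)) ∪ U (Ioi σ) ⊆
      {u | u ∈ V ∧ ∃ t ∈ P, f t + φ u = c} := by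
    rintro u ((h | h) | h) <;> exact ⟨h.1.1, h.2⟩
  calc volume {x | x ∈ W ∧ ∃ t ∈ P, f t + φ (t - x) = c}
      ≤ volume ((D (Iio (-σ)) ∪ D (Icc (-σ) σ)) ∪ D (Ioi σ)) := measure_mono hsub
    _ ≤ volume (D (Iio (-σ))) + volume (D (Icc (-σ) σ)) + volume (D (Ioi σ)) :=
        (measure_union_le _ _).trans (add_le_add_left (measure_union_le _ _) _)
    _ ≤ (volume P + volume (U (Iio (-σ)))) + (volume P + volume (U (Icc (-σ) σ))) +
        (volume P + volume (U (Ioi σ))) :=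
        add_le_add (add_le_add (volume_difference_le hP oc1 hPb (hUb _))
          (volume_difference_le hP oc2 hPb (hUb _))) (volume_difference_le hP oc3 hPb (hUb _))
    _ = 3 * volume P + (volume (U (Iio (-σ))) + volume (U (Icc (-σ) σ)) + volume (U (Ioi σ))) := by
        ring
    _ = 3 * volume P + volume ((U (Iio (-σ)) ∪ U (Icc (-σ) σ)) ∪ U (Ioi σ)) := by
        rw [measure_union hdis2 oc3.measurableSet, measure_union hdis1 oc2.measurableSet]
    _ ≤ _ := add_le_add_right (measure_mono hUsub) _

/-- The dyadic piece of order `m` and index `k` of the unit interval. -/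
def dyadicPiece (m k : ℕ) : Set ℝ := {t | t ∈ Icc (0 : ℝ) 1 ∧ dyadicIndex m t = k}

lemma ordConnected_dyadicPiece (m k : ℕ) : (dyadicPiece m k).OrdConnected := by
  refine ⟨?_⟩
  rintro a ⟨ha, hak⟩ b ⟨hb, hbk⟩ t ht
  refine ⟨⟨ha.1.trans ht.1, ht.2.trans hb.2⟩, ?_⟩
  rw [dyadicIndex_eq_iff (ha.1.trans ht.1)]
  exact ⟨((dyadicIndex_eq_iff ha.1).1 hak).1.trans ht.1,
    ht.2.trans_lt ((dyadicIndex_eq_iff hb.1).1 hbk).2⟩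

lemma isBounded_dyadicPiece (m k : ℕ) : Bornology.IsBounded (dyadicPiece m k) :=
  (Metric.isBounded_Icc 0 1).subset fun _ h => h.1

lemma sum_volume_dyadicPiece_le (m : ℕ) (s : Finset ℕ) :
    ∑ k ∈ s, volume (dyadicPiece m k) ≤ 1 := by
  rw [← measure_biUnion_finset]
  · calc volume (⋃ k ∈ s, dyadicPiece m k) ≤ volume (Icc (0 : ℝ) 1) :=
        measure_mono (iUnion₂_subset fun k _ t ht => ht.1)
      _ = 1 := by simp
  · intro j _ k _ hjk
    exact disjoint_left.2 fun t h1 h2 => hjk (h1.2.symm.trans h2.2)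
  · exact fun k _ => (ordConnected_dyadicPiece m k).measurableSet

lemma crossingCount_eq_iSup (z : ℝ → ℝ) (c : ℝ) :
    (crossingCount z c 0 1 : ℝ≥0∞) =
      ⨆ m, ((dyadicIndex m '' {t : ℝ | t ∈ Icc (0 : ℝ) 1 ∧ z t = c}).encard : ℝ≥0∞) := by
  rw [crossingCount, encard_eq_iSup_dyadic (fun t ht => ht.1.1), ENat.toENNReal_iSup]

open Classical in
lemma encard_dyadic_crossing_eq_sum (z : ℝ → ℝ) (c : ℝ) (m : ℕ) :
    ((dyadicIndex m '' {t : ℝ | t ∈ Icc (0 : ℝ) 1 ∧ z t = c}).encard : ℝ≥0∞) =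
      ∑ k ∈ Finset.range (2 ^ m + 1),
        if ∃ t ∈ dyadicPiece m k, z t = c then (1 : ℝ≥0∞) else 0 := by
  rw [encard_image_dyadicIndex_eq_sum (fun t ht => ht.1.2)]
  refine (map_sum ENat.toENNRealRingHom _ _).trans ?_
  refine Finset.sum_congr rfl fun k _ => ?_
  have : (∃ t ∈ {t : ℝ | t ∈ Icc (0 : ℝ) 1 ∧ z t = c}, dyadicIndex m t = k) ↔
      ∃ t ∈ dyadicPiece m k, z t = c := by
    constructor
    · rintro ⟨t, ⟨h1, h2⟩, h3⟩
      exact ⟨t, ⟨h1, h3⟩, h2⟩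
    · rintro ⟨t, ⟨h1, h3⟩, h2⟩
      exact ⟨t, ⟨h1, h2⟩, h3⟩
  simp only [this]
  split_ifs
  · exact ENat.toENNReal_one
  · exact ENat.toENNReal_zero

/-- Adding a continuous kernel with three monotone pieces at a uniform position of a window `W`
of the line changes the mean number of crossings in a controlled way. -/
theorem lintegral_crossingCount_translate_le (hf : Continuous f) (hφ : Continuous φ)
    (hl : MonotoneBranch φ (Iio (-σ))) (hm : MonotoneBranch φ (Icc (-σ) σ))
    (hr : MonotoneBranch φ (Ioi σ)) (hσ : 0 < σ) {W V : Set ℝ} (hW : MeasurableSet W)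
    (hV : V.OrdConnected) (hVb : Bornology.IsBounded V)
    (hWV : ∀ x ∈ W, ∀ t ∈ Icc (0 : ℝ) 1, t - x ∈ V) (c : ℝ) :
    ∫⁻ x in W, (crossingCount (fun t => f t + φ (t - x)) c 0 1 : ℝ≥0∞) ≤
      3 + ∫⁻ u in V, (crossingCount (fun t => f t + φ u) c 0 1 : ℝ≥0∞) := by
  classical
  simp only [crossingCount_eq_iSup (fun t => f t + φ (t - _))]
  have hsetmeas : ∀ m k, MeasurableSet {x | ∃ t ∈ dyadicPiece m k, f t + φ (t - x) = c} := by
    intro m k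
    have : {x | ∃ t ∈ dyadicPiece m k, f t + φ (t - x) = c} =
        (fun (x : ℝ) (q : ℚ) => f q + φ (q - x)) ⁻¹' {y | RatHits c m k y} := by
      ext x
      have := ratHits_iff (z := fun t => f t + φ (t - x)) (by fun_prop) c m k
      simp only [mem_preimage, mem_ofPred_eq, this]
      constructor
      · rintro ⟨t, ⟨h1, h3⟩, h2⟩
        exact ⟨t, ⟨h1, h2⟩, h3⟩
      · rintro ⟨t, ⟨h1, h2⟩, h3⟩
        exact ⟨t, ⟨h1, h3⟩, h2⟩
    rw [this]
    refine (measurableSet_ratHits c m k).preimage (measurable_pi_lambda _ fun q => ?_)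
    fun_prop
  rw [lintegral_iSup]
  rotate_left
  · intro m
    simp only [encard_dyadic_crossing_eq_sum]
    exact Finset.measurable_fun_sum _ fun k _ =>
      Measurable.ite (hsetmeas m k) measurable_const measurable_const
  · intro m n hmn x
    exact ENat.toENNReal_le.2 (encard_image_dyadicIndex_mono _ hmn)
  -- Monotone convergence has reduced the claim to one dyadic order `m`. The pieces have total
  -- length at most `1`, so the branch costs add up to at most `3`, uniformly in `m`.
  refine iSup_le fun m => ?_
  have hind : ∀ (S : Set ℝ) (p : ℝ → Prop), MeasurableSet S → MeasurableSet {x | x ∈ S ∧ p x} →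
      ∫⁻ x in S, (if p x then (1 : ℝ≥0∞) else 0) = volume {x | x ∈ S ∧ p x} := by
    intro S p hS hp
    rw [← lintegral_indicator hS, ← lintegral_indicator_one hp]
    refine lintegral_congr fun x => ?_
    by_cases h1 : x ∈ S <;> by_cases h2 : p x <;> simp [indicator, h1, h2]
  have hVmeas := hV.measurableSet
  have hlev : ∀ k, MeasurableSet {u | u ∈ V ∧ ∃ t ∈ dyadicPiece m k, f t + φ u = c} :=
    fun k => measurableSet_level hf hl hm hr hV (ordConnected_dyadicPiece m k) c
  have hlev' : ∀ k, MeasurableSet {u | ∃ t ∈ dyadicPiece m k, f t + φ u = c} := fun k => by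
    simpa using measurableSet_level hf hl hm hr ordConnected_univ (ordConnected_dyadicPiece m k) c
  calc ∫⁻ x in W, ((dyadicIndex m '' {t : ℝ | t ∈ Icc (0 : ℝ) 1 ∧ f t + φ (t - x) = c}).encard
        : ℝ≥0∞)
      = ∑ k ∈ Finset.range (2 ^ m + 1),
          volume {x | x ∈ W ∧ ∃ t ∈ dyadicPiece m k, f t + φ (t - x) = c} := by
        simp only [encard_dyadic_crossing_eq_sum]
        rw [lintegral_finsetSum _ fun k _ =>
          Measurable.ite (hsetmeas m k) measurable_const measurable_const]
        exact Finset.sum_congr rfl fun k _ => hind _ _ hW (hW.inter (hsetmeas m k))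
    _ ≤ ∑ k ∈ Finset.range (2 ^ m + 1), (3 * volume (dyadicPiece m k) +
          volume {u | u ∈ V ∧ ∃ t ∈ dyadicPiece m k, f t + φ u = c}) :=
        Finset.sum_le_sum fun k _ => volume_translate_level_le hf hl hm hr hσ hV hVb
          (ordConnected_dyadicPiece m k) (isBounded_dyadicPiece m k)
          (fun x hx t ht => hWV x hx t ht.1) c
    _ = 3 * ∑ k ∈ Finset.range (2 ^ m + 1), volume (dyadicPiece m k) +
          ∫⁻ u in V, ((dyadicIndex m '' {t : ℝ | t ∈ Icc (0 : ℝ) 1 ∧ f t + φ u = c}).encard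
            : ℝ≥0∞) := by
        rw [Finset.sum_add_distrib, ← Finset.mul_sum]
        congr 1
        simp only [encard_dyadic_crossing_eq_sum]
        rw [lintegral_finsetSum _ fun k _ =>
          Measurable.ite (hlev' k) measurable_const measurable_const]
        exact Finset.sum_congr rfl fun k _ => (hind _ _ hVmeas (hlev k)).symm
    _ ≤ 3 + ∫⁻ u in V, (crossingCount (fun t => f t + φ u) c 0 1 : ℝ≥0∞) := by
        refine add_le_add ?_ (lintegral_mono fun u => ENat.toENNReal_le.2 (encard_image_le _ _))
        calc 3 * ∑ k ∈ Finset.range (2 ^ m + 1), volume (dyadicPiece m k) ≤ 3 * 1 := by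
              gcongr
              exact sum_volume_dyadicPiece_le m _
          _ = 3 := mul_one 3

/-! ### Tangential crossings -/

/-- The positions `x` for which `f + φ (· - x)` has a multiple zero at a point `t` such that
`t - x` lies in an open set on which `φ` is injective with nonvanishing derivative. -/
lemma volume_tangential_branch {f f' φ φ' : ℝ → ℝ} (hf : ∀ t, HasDerivAt f (f' t) t)
    (hφ : ∀ u, HasStrictDerivAt φ (φ' u) u) {B : Set ℝ} (hB : IsOpen B) (hinj : InjOn φ B)
    (hne : ∀ u ∈ B, φ' u ≠ 0) :
    volume {x | ∃ t, t - x ∈ B ∧ f t + φ (t - x) = 0 ∧ f' t + φ' (t - x) = 0} = 0 := by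
  set ψ := Function.invFunOn φ B with hψ
  set θ : ℝ → ℝ := fun t => t - ψ (-f t) with hθ
  have hψinv : ∀ u ∈ B, ψ (φ u) = u := fun u hu => hinj.leftInvOn_invFunOn hu
  -- The inverse `ψ`, defined by choice, agrees near `φ u` with the local inverse of the inverse
  -- function theorem, by injectivity on the open set `B`.
  have hψd : ∀ u ∈ B, HasDerivAt ψ (φ' u)⁻¹ (φ u) := by
    intro u hu
    have hL := (hφ u).to_localInverse (hne u hu)
    refine hL.hasDerivAt.congr_of_eventuallyEq ?_
    have hLu : (hφ u).localInverse φ (φ' u) u (hne u hu) (φ u) = u :=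
      HasStrictFDerivAt.localInverse_apply_image _
    have hcont := hL.hasDerivAt.continuousAt
    have h1 : ∀ᶠ v in nhds (φ u), (hφ u).localInverse φ (φ' u) u (hne u hu) v ∈ B := by
      apply hcont.eventually_mem
      rw [hLu]
      exact hB.mem_nhds hu
    have h2 : ∀ᶠ v in nhds (φ u), φ ((hφ u).localInverse φ (φ' u) u (hne u hu) v) = v :=
      HasStrictFDerivAt.eventually_right_inverse _
    filter_upwards [h1, h2] with v hv1 hv2
    conv_lhs => rw [← hv2]
    exact hψinv _ hv1
  -- One-dimensional Sard: critical values form a null set, with differentiability needed only at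
  -- the critical points. At a zero, `x = θ t`; when the zero is multiple, `θ' t = 1 + f' t / φ' (t
  -- - x)` vanishes.
  have hnull : volume (θ '' {t | HasDerivAt θ 0 t}) = 0 := by
    refine addHaar_image_eq_zero_of_det_fderivWithin_eq_zero volume
      (f' := fun _ => (0 : ℝ →L[ℝ] ℝ)) (s := {t | HasDerivAt θ 0 t}) (fun t ht => ?_) (fun t _ => ?_)
    · have := (HasDerivAt.hasFDerivAt ht).hasFDerivWithinAt (s := {t | HasDerivAt θ 0 t})
      have h0 : ContinuousLinearMap.toSpanSingleton ℝ (0 : ℝ) = 0 := by ext; simp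
      rwa [h0] at this
    · simp [ContinuousLinearMap.det]
  refine measure_mono_null ?_ hnull
  rintro x ⟨t, hu, h1, h2⟩
  have hft : -f t = φ (t - x) := by linarith
  have hd : HasDerivAt θ 0 t := by
    have hψ' := hψd _ hu
    rw [← hft] at hψ'
    refine ((hasDerivAt_id t).sub (hψ'.comp t (hf t).neg)).congr_deriv ?_
    have hf' : f' t = -φ' (t - x) := by linarith
    rw [hf', neg_neg, inv_mul_cancel₀ (hne _ hu), sub_self]
  refine ⟨t, hd, ?_⟩
  simp only [hθ]
  rw [hft, hψinv _ hu]
  ring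

/-! ### Rolle's theorem for crossing counts -/

/-- Between two crossings lies a zero of the derivative, so the two sets interleave; if the
derivative has infinitely many zeros there is nothing to prove. -/
lemma crossingCount_le_crossingCount_deriv_add_one {f f' : ℝ → ℝ}
    (hf : ∀ t, HasDerivAt f (f' t) t) (α a b : ℝ) :
    crossingCount f α a b ≤ crossingCount f' 0 a b + 1 := by
  unfold crossingCount
  by_cases hT : {t | t ∈ Icc a b ∧ f' t = 0}.Finite
  · refine ENat.forall_natCast_le_iff_le.1 fun n hn => ?_
    obtain ⟨s, hsA, hs⟩ := exists_subset_encard_eq hn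
    have hfin : s.Finite := finite_of_encard_eq_coe hs
    rw [← hs, hfin.encard_eq_coe_toFinset_card, hT.encard_eq_coe_toFinset_card]
    have : hfin.toFinset.card ≤ hT.toFinset.card + 1 := by
      refine Finset.card_le_of_interleaved fun x hx y hy hxy _ => ?_
      have hx' := hsA (hfin.mem_toFinset.1 hx)
      have hy' := hsA (hfin.mem_toFinset.1 hy)
      obtain ⟨z, hz, hz0⟩ := exists_hasDerivAt_eq_zero (f := f) (f' := f') hxy
        (fun t _ => (hf t).continuousAt.continuousWithinAt) (hx'.2.trans hy'.2.symm)
        (fun t _ => hf t)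
      exact ⟨z, hT.mem_toFinset.2 ⟨⟨hx'.1.1.trans hz.1.le, hz.2.le.trans hy'.1.2⟩, hz0⟩, hz⟩
    exact_mod_cast this
  · rw [Set.Infinite.encard_eq hT]
    simp

end ShotNoise

end

noncomputable section

namespace ShotNoise

/-! ### The size-bias identity for independent Poisson variables -/

lemma succ_mul_poissonMeasure_singleton (r : ℝ≥0) (n : ℕ) :
    ((n + 1 : ℕ) : ℝ≥0∞) * poissonMeasure r {n + 1} = r * poissonMeasure r {n} := by
  rw [poissonMeasure_singleton, poissonMeasure_singleton, ← ENNReal.ofReal_natCast,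
    ← ENNReal.ofReal_coe_nnreal, ← ENNReal.ofReal_mul (by positivity),
    ← ENNReal.ofReal_mul (by positivity)]
  congr 1
  rw [Nat.factorial_succ, pow_succ]
  push_cast
  have : (n.factorial : ℝ) ≠ 0 := by positivity
  field_simp

/-- The identity `(n + 1) p (n + 1) = r p n` in coordinate `k`: terms with `n k = 0` vanish, and the
others are reindexed by removing one point from cell `k`. -/
lemma lintegral_mul_pi_poissonMeasure {K : Type*} [Fintype K] [DecidableEq K] (r : K → ℝ≥0) (k : K)
    (F : (K → ℕ) → ℝ≥0∞) :
    ∫⁻ n, (n k : ℝ≥0∞) * F n ∂Measure.pi (fun i => poissonMeasure (r i)) =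
      r k * ∫⁻ n, F (n + Pi.single k 1) ∂Measure.pi (fun i => poissonMeasure (r i)) := by
  rw [lintegral_countable', lintegral_countable', ← ENNReal.tsum_mul_left]
  simp only [Measure.pi_singleton]
  have hinj : Function.Injective fun n : K → ℕ => n + Pi.single k 1 := add_left_injective _
  rw [← hinj.tsum_eq]
  · refine tsum_congr fun n => ?_
    rw [← Finset.mul_prod_erase Finset.univ _ (Finset.mem_univ k),
      ← Finset.mul_prod_erase Finset.univ (fun i => poissonMeasure (r i) {n i})
        (Finset.mem_univ k)]
    have h1 : ∏ i ∈ Finset.univ.erase k, poissonMeasure (r i) {(n + Pi.single k 1 : K → ℕ) i} =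
        ∏ i ∈ Finset.univ.erase k, poissonMeasure (r i) {n i} := by
      refine Finset.prod_congr rfl fun i hi => ?_
      rw [Pi.add_apply, Pi.single_eq_of_ne (Finset.ne_of_mem_erase hi), add_zero]
    have h2 : (n + Pi.single k 1 : K → ℕ) k = n k + 1 := by simp
    rw [h1, h2]
    have h3 := succ_mul_poissonMeasure_singleton (r k) (n k)
    calc _ = (((n k + 1 : ℕ) : ℝ≥0∞) * poissonMeasure (r k) {n k + 1}) *
          (F (n + Pi.single k 1) * ∏ i ∈ Finset.univ.erase k, poissonMeasure (r i) {n i}) := by ring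
      _ = _ := by rw [h3]; ring
  · intro n hn
    have hnk : n k ≠ 0 := by
      intro h
      simp [h] at hn
    refine ⟨n - Pi.single k 1, ?_⟩
    ext i
    by_cases hi : i = k
    · subst hi
      simp only [Pi.add_apply, Pi.sub_apply, Pi.single_eq_same]
      omega
    · simp [hi]

/-! ### Counting variables of a Poisson process -/

variable {Ω : Type*} {lam : ℝ} {τ : ℕ → Ω → ℝ}

/-- The number of points in `B`, as a natural number. -/
def natCount (τ : ℕ → Ω → ℝ) (B : Set ℝ) (ω : Ω) : ℕ := (pointCount τ B ω).toNat

lemma pointCount_eq_tsum (τ : ℕ → Ω → ℝ) (B : Set ℝ) (ω : Ω) :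
    (pointCount τ B ω : ℝ≥0∞) = ∑' i, B.indicator 1 (τ i ω) := by
  rw [pointCount, ← ENNReal.tsum_set_one, tsum_subtype {i | τ i ω ∈ B} (fun _ => (1 : ℝ≥0∞))]
  rfl

/-- Along a sequence with `∑ (1 + τ i ^ 2)⁻¹ < ∞` every bounded set contains finitely many
points. -/
lemma finite_mem_of_summable {x : ℕ → ℝ} (hx : Summable fun i => (1 + x i ^ 2)⁻¹) {B : Set ℝ}
    (hB : Bornology.IsBounded B) : {i | x i ∈ B}.Finite := by
  obtain ⟨R, hR⟩ := hB.subset_closedBall 0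
  have hpos : (0 : ℝ) < (1 + R ^ 2)⁻¹ := by positivity
  have h := hx.tendsto_cofinite_zero.eventually_lt_const hpos
  rw [Filter.eventually_cofinite] at h
  refine h.subset fun i hi => ?_
  have hi' : |x i| ≤ R := by simpa using hR hi
  simp only [mem_ofPred_eq, not_lt]
  have : x i ^ 2 ≤ R ^ 2 := by
    rw [← sq_abs]
    gcongr
  gcongr

lemma natCount_eq_tsum {ω : Ω} (hω : Summable fun i => (1 + τ i ω ^ 2)⁻¹) {B : Set ℝ}
    (hB : Bornology.IsBounded B) : (natCount τ B ω : ℝ) = ∑' i, B.indicator 1 (τ i ω) := by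
  have hfin := finite_mem_of_summable hω hB
  rw [tsum_eq_sum (s := hfin.toFinset)]
  · rw [natCount, pointCount, hfin.encard_eq_coe_toFinset_card, ENat.toNat_natCast,
      Finset.sum_congr rfl (g := fun _ => (1 : ℝ))]
    · simp
    · intro i hi
      have : τ i ω ∈ B := hfin.mem_toFinset.1 hi
      simp [this]
  · intro i hi
    have : τ i ω ∉ B := fun h => hi (hfin.mem_toFinset.2 h)
    simp [this]

variable [MeasurableSpace Ω] {μ : Measure Ω}

lemma IsPoissonProcess.measurable_pointCount (hτ : IsPoissonProcess μ lam τ) {B : Set ℝ}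
    (hB : MeasurableSet B) : Measurable (pointCount τ B) := by
  rw [measurable_enat_iff]
  simp only [pointCount_eq_tsum]
  exact Measurable.tsum fun i =>
    (measurable_one.indicator hB).comp (hτ.measurable_point i)

lemma IsPoissonProcess.measurable_natCount (hτ : IsPoissonProcess μ lam τ) {B : Set ℝ}
    (hB : MeasurableSet B) : Measurable (natCount τ B) :=
  (measurable_of_countable _).comp (hτ.measurable_pointCount hB)

lemma IsPoissonProcess.map_natCount (hτ : IsPoissonProcess μ lam τ) {B : Set ℝ}
    (hB : MeasurableSet B) (hBv : volume B ≠ ∞) :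
    μ.map (natCount τ B) = poissonMeasure (lam * volume.real B).toNNReal := by
  have h := (hτ.law_count B hB hBv).map_eq
  have : natCount τ B = ENat.toNat ∘ pointCount τ B := rfl
  rw [this, ← Measure.map_map (measurable_of_countable _) (hτ.measurable_pointCount hB), h,
    Measure.map_map (measurable_of_countable _) (measurable_of_countable _)]
  have : (ENat.toNat ∘ fun k : ℕ => (k : ℕ∞)) = id := by ext; simp
  rw [this, Measure.map_id]

lemma IsPoissonProcess.ae_pointCount_ne_top (hτ : IsPoissonProcess μ lam τ) {B : Set ℝ}
    (hB : MeasurableSet B) (hBv : volume B ≠ ∞) : ∀ᵐ ω ∂μ, pointCount τ B ω ≠ ⊤ := by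
  have h := (hτ.law_count B hB hBv).map_eq
  have h1 : μ.map (pointCount τ B) {⊤} = 0 := by
    rw [h, Measure.map_apply (measurable_of_countable _) (measurableSet_singleton _)]
    have : (fun k : ℕ => (k : ℕ∞)) ⁻¹' {⊤} = ∅ := by ext; simp
    rw [this, measure_empty]
  rw [Measure.map_apply (hτ.measurable_pointCount hB) (measurableSet_singleton _)] at h1
  rw [ae_iff]
  convert h1 using 2
  ext ω
  simp

lemma IsPoissonProcess.map_natCount_pi [IsProbabilityMeasure μ] (hτ : IsPoissonProcess μ lam τ)
    {K : Type*} [Fintype K] {B : K → Set ℝ} (hB : ∀ k, MeasurableSet (B k))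
    (hBv : ∀ k, volume (B k) ≠ ∞) (hdis : Pairwise fun j k => Disjoint (B j) (B k)) :
    μ.map (fun ω k => natCount τ (B k) ω) =
      Measure.pi fun k => poissonMeasure (lam * volume.real (B k)).toNNReal := by
  have e := Fintype.equivFin K
  have hind := hτ.indep_count _ (fun j => B (e.symm j)) (fun j => hB _)
    (fun j k hjk => hdis (e.symm.injective.ne hjk))
  have hind' : iIndepFun (fun k => pointCount τ (B k)) μ := by
    have := hind.precomp e.injective
    simpa using this
  have hind'' : iIndepFun (fun k => natCount τ (B k)) μ :=
    hind'.comp (fun _ => ENat.toNat) (fun _ => measurable_of_countable _)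
  rw [(iIndepFun_iff_map_fun_eq_pi_map
    (fun k => (hτ.measurable_natCount (hB k)).aemeasurable)).1 hind'']
  simp only [hτ.map_natCount (hB _) (hBv _)]

lemma IsPoissonProcess.lintegral_natCount (hτ : IsPoissonProcess μ lam τ)
    {B : Set ℝ} (hB : MeasurableSet B) (hBv : volume B ≠ ∞) :
    ∫⁻ ω, (natCount τ B ω : ℝ≥0∞) ∂μ = ENNReal.ofReal lam * volume B := by
  have h : ∫⁻ ω, (natCount τ B ω : ℝ≥0∞) ∂μ =
      ∫⁻ n : ℕ, (n : ℝ≥0∞) ∂poissonMeasure (lam * volume.real B).toNNReal := by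
    rw [← hτ.map_natCount hB hBv, lintegral_map (measurable_of_countable _)
      (hτ.measurable_natCount hB)]
  have h2 := lintegral_mul_pi_poissonMeasure (K := Unit)
    (fun _ => (lam * volume.real B).toNNReal) () (fun _ => 1)
  have h3 := (measurePreserving_eval (fun _ : Unit => poissonMeasure
    (lam * volume.real B).toNNReal) ()).lintegral_comp
    (f := fun n : ℕ => (n : ℝ≥0∞)) (measurable_of_countable _)
  simp only [mul_one, lintegral_one, measure_univ] at h2
  have h4 : ENNReal.ofReal (volume.real B) = volume B := ENNReal.ofReal_toReal hBv
  rw [h, ← h3, ← h4]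
  refine h2.trans ?_
  rw [← ENNReal.ofReal_mul' measureReal_nonneg]
  rfl

/-! ### The mean measure and summability of decaying functions along the points -/

/-- Campbell's formula: the mean counts determine both sides on sets of finite volume, and these
exhaust the line. -/
lemma IsPoissonProcess.sum_map_eq (hτ : IsPoissonProcess μ lam τ) :
    Measure.sum (fun i => μ.map (τ i)) = ENNReal.ofReal lam • (volume : Measure ℝ) := by
  have hfin : ∀ B : Set ℝ, MeasurableSet B → volume B ≠ ∞ →
      Measure.sum (fun i => μ.map (τ i)) B = ENNReal.ofReal lam * volume B := by
    intro B hB hBv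
    rw [← hτ.lintegral_natCount hB hBv, Measure.sum_apply _ hB]
    have h1 : ∀ i, μ.map (τ i) B = ∫⁻ ω, B.indicator 1 (τ i ω) ∂μ := fun i => by
      rw [← lintegral_indicator_one hB, lintegral_map (measurable_one.indicator hB)
        (hτ.measurable_point i)]
    simp only [h1]
    rw [← lintegral_tsum (f := fun i ω => B.indicator (1 : ℝ → ℝ≥0∞) (τ i ω)) fun i =>
      ((measurable_one.indicator hB).comp (hτ.measurable_point i)).aemeasurable]
    refine lintegral_congr_ae ?_
    filter_upwards [hτ.ae_pointCount_ne_top hB hBv] with ω hω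
    rw [← pointCount_eq_tsum, natCount]
    conv_lhs => rw [← ENat.natCast_toNat hω]
    simp
  rw [Measure.ext_iff_of_iUnion_eq_univ (s := fun n : ℕ => Icc (-(n : ℝ)) n)]
  · intro n
    ext B hB
    have hv : volume (B ∩ Icc (-(n : ℝ)) n) ≠ ∞ :=
      ((measure_mono inter_subset_right).trans_lt measure_Icc_lt_top).ne
    rw [Measure.restrict_apply hB, Measure.restrict_apply hB,
      hfin _ (hB.inter measurableSet_Icc) hv]
    simp
  · rw [eq_univ_iff_forall]
    intro x
    obtain ⟨n, hn⟩ := exists_nat_ge |x|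
    exact mem_iUnion.2 ⟨n, abs_le.1 hn⟩

/-- By Campbell's formula the sum has finite mean, `(1 + s ^ 2)⁻¹` being integrable. This one almost
sure event controls local finiteness, convergence and smoothness of the paths. -/
lemma IsPoissonProcess.ae_summable (hτ : IsPoissonProcess μ lam τ) :
    ∀ᵐ ω ∂μ, Summable fun i => (1 + τ i ω ^ 2)⁻¹ := by
  have hm : Measurable fun s : ℝ => ENNReal.ofReal (1 + s ^ 2)⁻¹ := by fun_prop
  have h1 : ∫⁻ ω, ∑' i, ENNReal.ofReal (1 + τ i ω ^ 2)⁻¹ ∂μ =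
      ENNReal.ofReal lam * ∫⁻ s : ℝ, ENNReal.ofReal (1 + s ^ 2)⁻¹ := by
    rw [lintegral_tsum (f := fun i ω => ENNReal.ofReal (1 + τ i ω ^ 2)⁻¹) fun i => (hm.comp (hτ.measurable_point i)).aemeasurable,
      ← smul_eq_mul, ← lintegral_smul_measure, ← hτ.sum_map_eq, lintegral_sum_measure]
    exact tsum_congr fun i => (lintegral_map hm (hτ.measurable_point i)).symm
  have h2 : ∫⁻ s : ℝ, ENNReal.ofReal (1 + s ^ 2)⁻¹ ≠ ∞ := by
    have := (integrable_inv_one_add_sq).lintegral_lt_top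
    exact this.ne
  have h3 := ae_lt_top (μ := μ) (f := fun ω => ∑' i, ENNReal.ofReal (1 + τ i ω ^ 2)⁻¹)
    (Measurable.tsum fun i => hm.comp (hτ.measurable_point i))
    (by rw [h1]; exact ENNReal.mul_ne_top ENNReal.ofReal_ne_top h2)
  filter_upwards [h3] with ω hω
  have := ENNReal.summable_toReal hω.ne
  refine this.congr fun i => ENNReal.toReal_ofReal (by positivity)

end ShotNoise

end

noncomputable section

namespace ShotNoise

/-! ### Discretisation of linear statistics of the points -/

/-- The largest multiple of `2⁻ᵐ` not exceeding `s`. -/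
def dyadicFloor (m : ℕ) (s : ℝ) : ℝ := ⌊2 ^ m * s⌋ / 2 ^ m

lemma dyadicFloor_le (m : ℕ) (s : ℝ) : dyadicFloor m s ≤ s := by
  unfold dyadicFloor
  rw [div_le_iff₀ (by positivity), mul_comm s]
  exact Int.floor_le _

lemma lt_dyadicFloor_add (m : ℕ) (s : ℝ) : s < dyadicFloor m s + 1 / 2 ^ m := by
  unfold dyadicFloor
  rw [← add_div, lt_div_iff₀ (by positivity), mul_comm s]
  exact Int.lt_floor_add_one _

lemma abs_dyadicFloor_sub_le (m : ℕ) (s : ℝ) : |dyadicFloor m s - s| ≤ 1 / 2 ^ m := by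
  rw [abs_le]
  constructor <;> linarith [dyadicFloor_le m s, lt_dyadicFloor_add m s,
    show (0 : ℝ) < 1 / 2 ^ m by positivity]

lemma tendsto_dyadicFloor (s : ℝ) :
    Filter.Tendsto (fun m => dyadicFloor m s) Filter.atTop (nhds s) := by
  rw [tendsto_iff_dist_tendsto_zero]
  refine squeeze_zero (fun _ => dist_nonneg) (fun m => abs_dyadicFloor_sub_le m s) ?_
  simpa using tendsto_pow_atTop_nhds_zero_of_lt_one (r := (1 / 2 : ℝ)) (by norm_num) (by norm_num)

lemma measurable_dyadicFloor (m : ℕ) : Measurable (dyadicFloor m) := by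
  unfold dyadicFloor
  fun_prop

lemma inv_one_add_dyadicFloor_sq_le (m : ℕ) (s : ℝ) :
    (1 + dyadicFloor m s ^ 2)⁻¹ ≤ 3 * (1 + s ^ 2)⁻¹ := by
  have h := abs_dyadicFloor_sub_le m s
  have h1 : (1 : ℝ) / 2 ^ m ≤ 1 := by
    rw [div_le_one (by positivity)]
    exact one_le_pow₀ (by norm_num)
  have h2 : (dyadicFloor m s - s) ^ 2 ≤ 1 := by
    rw [← sq_abs]
    have := abs_nonneg (dyadicFloor m s - s)
    nlinarith
  rw [← div_eq_mul_inv, le_div_iff₀ (by positivity), inv_mul_le_iff₀ (by positivity)]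
  nlinarith [sq_nonneg (dyadicFloor m s + (dyadicFloor m s - s))]

/-- The dyadic cell `[k 2⁻ᵐ, (k + 1) 2⁻ᵐ)`. -/
def dyadicCell (m : ℕ) (k : ℤ) : Set ℝ := {s | ⌊2 ^ m * s⌋ = k}

lemma dyadicCell_eq (m : ℕ) (k : ℤ) :
    dyadicCell m k = Ico ((k : ℝ) / 2 ^ m) ((k + 1 : ℝ) / 2 ^ m) := by
  ext s
  simp only [dyadicCell, mem_ofPred_eq, Int.floor_eq_iff, mem_Ico]
  rw [div_le_iff₀ (by positivity), lt_div_iff₀ (by positivity), mul_comm s]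

lemma measurableSet_dyadicCell (m : ℕ) (k : ℤ) : MeasurableSet (dyadicCell m k) := by
  rw [dyadicCell_eq]
  exact measurableSet_Ico

lemma volume_dyadicCell (m : ℕ) (k : ℤ) : volume (dyadicCell m k) = ENNReal.ofReal (1 / 2 ^ m) := by
  rw [dyadicCell_eq, Real.volume_Ico]
  congr 1
  ring

lemma isBounded_dyadicCell (m : ℕ) (k : ℤ) : Bornology.IsBounded (dyadicCell m k) := by
  rw [dyadicCell_eq]
  exact Metric.isBounded_Ico _ _

lemma disjoint_dyadicCell (m : ℕ) {j k : ℤ} (h : j ≠ k) :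
    Disjoint (dyadicCell m j) (dyadicCell m k) :=
  disjoint_left.2 fun _ h1 h2 => h (h1.symm.trans h2)

lemma dyadicFloor_of_mem {m : ℕ} {k : ℤ} {s : ℝ} (h : s ∈ dyadicCell m k) :
    dyadicFloor m s = k / 2 ^ m := by
  unfold dyadicFloor
  rw [show ⌊2 ^ m * s⌋ = k from h]

/-- The indices of the dyadic cells of order `m` contained in `[-R, R)`. -/
def cellRange (R m : ℕ) : Finset ℤ := Finset.Ico (-(R * 2 ^ m : ℤ)) (R * 2 ^ m)

/-- The endpoints `±R` are integers, hence multiples of `2⁻ᵐ`, so the window is exactly a union of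
cells at every order. -/
lemma floor_mem_cellRange {R m : ℕ} {s : ℝ} :
    ⌊2 ^ m * s⌋ ∈ cellRange R m ↔ s ∈ Ico (-(R : ℝ)) R := by
  have hp : (0 : ℝ) < 2 ^ m := by positivity
  rw [cellRange, Finset.mem_Ico, Int.le_floor, Int.floor_lt, mem_Ico]
  push_cast
  constructor
  · rintro ⟨h1, h2⟩
    constructor <;> nlinarith
  · rintro ⟨h1, h2⟩
    constructor <;> nlinarith

lemma Ico_eq_biUnion_dyadicCell (R m : ℕ) :
    Ico (-(R : ℝ)) R = ⋃ k ∈ cellRange R m, dyadicCell m k := by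
  ext s
  rw [← floor_mem_cellRange (m := m)]
  simp [dyadicCell]

variable {Ω : Type*} {lam : ℝ} {τ : ℕ → Ω → ℝ}

lemma sum_natCount_mul {ω : Ω} (hω : Summable fun i => (1 + τ i ω ^ 2)⁻¹) (m : ℕ) (T : Finset ℤ)
    (c : ℤ → ℝ) :
    ∑ k ∈ T, natCount τ (dyadicCell m k) ω * c k =
      ∑' i, if ⌊2 ^ m * τ i ω⌋ ∈ T then c ⌊2 ^ m * τ i ω⌋ else 0 := by
  have h1 : ∀ k, natCount τ (dyadicCell m k) ω * c k =
      ∑' i, (dyadicCell m k).indicator 1 (τ i ω) * c k := fun k => by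
    rw [natCount_eq_tsum hω (isBounded_dyadicCell m k), tsum_mul_right]
  simp only [h1]
  rw [← Summable.tsum_finsetSum]
  · refine tsum_congr fun i => ?_
    simp only [indicator_apply, dyadicCell, mem_ofPred_eq, Pi.one_apply, ite_mul, one_mul,
      zero_mul]
    rw [Finset.sum_ite_eq]
  · intro k _
    refine summable_of_hasFiniteSupport
      ((finite_mem_of_summable hω (isBounded_dyadicCell m k)).subset fun i hi => ?_)
    by_contra h
    have : τ i ω ∉ dyadicCell m k := h
    simp [this] at hi

lemma sum_natCount_cellRange {ω : Ω} (hω : Summable fun i => (1 + τ i ω ^ 2)⁻¹) (R m : ℕ) :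
    ∑ k ∈ cellRange R m, natCount τ (dyadicCell m k) ω = natCount τ (Ico (-(R : ℝ)) R) ω := by
  have h := sum_natCount_mul hω m (cellRange R m) (fun _ => 1)
  have h' := natCount_eq_tsum hω (Metric.isBounded_Ico (-(R : ℝ)) R)
  simp only [floor_mem_cellRange, mul_one] at h
  have : (∑ k ∈ cellRange R m, natCount τ (dyadicCell m k) ω : ℝ) =
      natCount τ (Ico (-(R : ℝ)) R) ω := by
    rw [h, h']
    simp only [indicator_apply, Pi.one_apply]
  exact_mod_cast this

/-- A family of functions decaying quadratically and approximated by their values at dyadic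
points from the left. -/
structure IsDecayingFamily {ι : Type*} (h : ι → ℝ → ℝ) : Prop where
  measurable : ∀ j, Measurable (h j)
  decay : ∀ j, ∃ C, ∀ s, |h j s| ≤ C * (1 + s ^ 2)⁻¹
  tendsto : ∀ j s, Filter.Tendsto (fun m => h j (dyadicFloor m s)) Filter.atTop (nhds (h j s))

variable {ι : Type*} {h : ι → ℝ → ℝ}

/-- The family of sums `∑ i, h j (τ i)`, `j : ι`. -/
def linearStat (h : ι → ℝ → ℝ) (τ : ℕ → Ω → ℝ) (ω : Ω) (j : ι) : ℝ := ∑' i, h j (τ i ω)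

/-- The linear statistic computed from the numbers of points in the dyadic cells. -/
def cellStat (h : ι → ℝ → ℝ) (m : ℕ) (n : cellRange m m → ℕ) (j : ι) : ℝ :=
  ∑ k, n k * h j (k / 2 ^ m)

/-- The numbers of points in the dyadic cells of order `m` contained in `[-m, m)`. -/
def cellCount (τ : ℕ → Ω → ℝ) (m : ℕ) (ω : Ω) (k : cellRange m m) : ℕ :=
  natCount τ (dyadicCell m k) ω

/-- Rounding each point down to its cell gives a sum over points, truncated to `[-m, m)`. It
converges termwise and is dominated by `3 C (1 + τ i ω ^ 2)⁻¹`, since rounding moves a point by at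
most `1`. -/
lemma IsDecayingFamily.tendsto_cellStat (hh : IsDecayingFamily h) {ω : Ω}
    (hω : Summable fun i => (1 + τ i ω ^ 2)⁻¹) :
    Filter.Tendsto (fun m => cellStat h m (cellCount τ m ω)) Filter.atTop
      (nhds (linearStat h τ ω)) := by
  rw [tendsto_pi_nhds]
  intro j
  have h1 : ∀ m, cellStat h m (cellCount τ m ω) j =
      ∑' i, if ⌊2 ^ m * τ i ω⌋ ∈ cellRange m m then h j (dyadicFloor m (τ i ω)) else 0 := by
    intro m
    unfold cellStat cellCount dyadicFloor
    rw [← sum_natCount_mul hω m (cellRange m m) (fun k => h j (k / 2 ^ m))]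
    exact Finset.sum_coe_sort (cellRange m m)
      (fun k => (natCount τ (dyadicCell m k) ω : ℝ) * h j (k / 2 ^ m))
  simp only [h1]
  obtain ⟨C, hC⟩ := hh.decay j
  have hC0 : 0 ≤ C := by
    have := (abs_nonneg _).trans (hC 0)
    simpa using this
  refine tendsto_tsum_of_dominated_convergence (bound := fun i => C * (3 * (1 + τ i ω ^ 2)⁻¹))
    ((hω.mul_left 3).mul_left C) (fun i => ?_) (Filter.Eventually.of_forall fun m i => ?_)
  · refine (hh.tendsto j (τ i ω)).congr' ?_
    obtain ⟨N, hN⟩ := exists_nat_gt |τ i ω|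
    filter_upwards [Filter.eventually_ge_atTop N] with m hm
    rw [if_pos]
    rw [floor_mem_cellRange]
    have : (N : ℝ) ≤ m := by exact_mod_cast hm
    exact ⟨by linarith [neg_abs_le (τ i ω)], by linarith [le_abs_self (τ i ω)]⟩
  · split_ifs
    · rw [Real.norm_eq_abs]
      exact (hC _).trans (mul_le_mul_of_nonneg_left (inv_one_add_dyadicFloor_sq_le m _) hC0)
    · rw [norm_zero]
      positivity

lemma cellStat_add_single {m : ℕ} [DecidableEq (cellRange m m)] (n : cellRange m m → ℕ)
    (k : cellRange m m) :
    cellStat h m (n + Pi.single k 1) = cellStat h m n + fun j => h j (k / 2 ^ m) := by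
  ext j
  simp only [cellStat, Pi.add_apply, Nat.cast_add, add_mul, Finset.sum_add_distrib]
  congr 1
  rw [Finset.sum_eq_single k]
  · simp
  · intro i _ hi
    simp [hi]
  · simp

variable [MeasurableSpace Ω] {μ : Measure Ω}

lemma IsPoissonProcess.measurable_cellCount (hτ : IsPoissonProcess μ lam τ) (m : ℕ) :
    Measurable (cellCount τ m) :=
  measurable_pi_lambda _ fun k => hτ.measurable_natCount (measurableSet_dyadicCell m k)

lemma measurable_cellStat (h : ι → ℝ → ℝ) (m : ℕ) : Measurable (cellStat h m) :=
  measurable_of_countable _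

lemma IsPoissonProcess.map_cellCount [IsProbabilityMeasure μ] (hτ : IsPoissonProcess μ lam τ)
    (m : ℕ) :
    μ.map (cellCount τ m) = Measure.pi fun _ => poissonMeasure (lam * (1 / 2 ^ m)).toNNReal := by
  have := hτ.map_natCount_pi (B := fun k : cellRange m m => dyadicCell m k)
    (fun k => measurableSet_dyadicCell m k) (fun k => by simp [volume_dyadicCell])
    (fun j k hjk => disjoint_dyadicCell m (Subtype.coe_injective.ne hjk))
  simp only [Measure.real, volume_dyadicCell] at this
  have h2 : (ENNReal.ofReal (1 / 2 ^ m)).toReal = 1 / 2 ^ m :=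
    ENNReal.toReal_ofReal (by positivity)
  rw [h2] at this
  exact this

lemma IsPoissonProcess.aemeasurable_linearStat [Countable ι] (hτ : IsPoissonProcess μ lam τ)
    (hh : IsDecayingFamily h) : AEMeasurable (linearStat h τ) μ := by
  refine aemeasurable_of_tendsto_metrizable_ae Filter.atTop
    (fun m => ((measurable_cellStat h m).comp (hτ.measurable_cellCount m)).aemeasurable) ?_
  filter_upwards [hτ.ae_summable] with ω hω
  exact hh.tendsto_cellStat hω

/-- The law of a linear statistic depends only on the intensity of the Poisson process. -/
theorem IsPoissonProcess.map_linearStat_eq [Countable ι] [IsProbabilityMeasure μ]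
    (hτ : IsPoissonProcess μ lam τ) {τ' : ℕ → Ω → ℝ} (hτ' : IsPoissonProcess μ lam τ')
    (hh : IsDecayingFamily h) : μ.map (linearStat h τ) = μ.map (linearStat h τ') := by
  have : IsProbabilityMeasure (μ.map (linearStat h τ)) :=
    Measure.isProbabilityMeasure_map (hτ.aemeasurable_linearStat hh)
  -- Bounded continuous tests determine the law and pass to the limit along the cell statistics,
  -- whose laws are explicit and the same for `τ` and `τ'`.
  refine ext_of_forall_lintegral_eq_of_IsFiniteMeasure fun G => ?_
  have hG : Measurable fun y => (G y : ℝ≥0∞) := by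
    exact measurable_coe_nnreal_ennreal.comp G.continuous.measurable
  have lim : ∀ {τ : ℕ → Ω → ℝ}, IsPoissonProcess μ lam τ →
      Filter.Tendsto (fun m => ∫⁻ ω, (G (cellStat h m (cellCount τ m ω)) : ℝ≥0∞) ∂μ) Filter.atTop
        (nhds (∫⁻ ω, (G (linearStat h τ ω) : ℝ≥0∞) ∂μ)) := by
    intro τ hτ
    refine tendsto_lintegral_of_dominated_convergence (fun _ => (nndist G 0 : ℝ≥0∞))
      (fun m => hG.comp ((measurable_cellStat h m).comp (hτ.measurable_cellCount m)))
      (fun m => Filter.Eventually.of_forall fun ω => ?_) (by simp) ?_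
    · exact ENNReal.coe_le_coe.2 (BoundedContinuousFunction.NNReal.upper_bound G _)
    · filter_upwards [hτ.ae_summable] with ω hω
      refine (ENNReal.continuous_coe.tendsto _).comp ((G.continuous.tendsto _).comp ?_)
      exact hh.tendsto_cellStat hω
  have hlaw : ∀ {τ : ℕ → Ω → ℝ}, IsPoissonProcess μ lam τ → ∀ m,
      ∫⁻ ω, (G (cellStat h m (cellCount τ m ω)) : ℝ≥0∞) ∂μ =
      ∫⁻ n, (G (cellStat h m n) : ℝ≥0∞) ∂Measure.pi fun _ =>
        poissonMeasure (lam * (1 / 2 ^ m)).toNNReal := by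
    intro τ hτ m
    rw [← hτ.map_cellCount m, lintegral_map (measurable_of_countable _)
      (hτ.measurable_cellCount m)]
  rw [lintegral_map' hG.aemeasurable (hτ.aemeasurable_linearStat hh),
    lintegral_map' hG.aemeasurable (hτ'.aemeasurable_linearStat hh)]
  refine tendsto_nhds_unique (lim hτ) ?_
  refine (lim hτ').congr fun m => ?_
  rw [hlaw hτ, hlaw hτ']

/-- The size-bias identity for functions of the counts in dyadic cells. -/
lemma IsPoissonProcess.lintegral_natCount_mul_cellStat [IsProbabilityMeasure μ]
    (hlam : 0 ≤ lam) (hτ : IsPoissonProcess μ lam τ) {R m : ℕ} (hRm : R ≤ m)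
    (G : (ι → ℝ) → ℝ≥0∞) :
    ∫⁻ ω, (natCount τ (Ico (-(R : ℝ)) R) ω : ℝ≥0∞) * G (cellStat h m (cellCount τ m ω)) ∂μ =
      ENNReal.ofReal lam * ∫⁻ x in Ico (-(R : ℝ)) R,
        ∫⁻ ω, G (cellStat h m (cellCount τ m ω) + fun j => h j (dyadicFloor m x)) ∂μ := by
  classical
  set r : ℝ≥0 := (lam * (1 / 2 ^ m)).toNNReal with hr
  have hr' : (r : ℝ≥0∞) = ENNReal.ofReal lam * ENNReal.ofReal (1 / 2 ^ m) := by
    rw [← ENNReal.ofReal_mul hlam]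
    rfl
  have hsub : cellRange R m ⊆ cellRange m m := by
    have : (R : ℤ) * 2 ^ m ≤ m * 2 ^ m := by
      have : (R : ℤ) ≤ m := by exact_mod_cast hRm
      gcongr
    exact Finset.Ico_subset_Ico (by linarith) this
  have hlaw : ∀ F : (cellRange m m → ℕ) → ℝ≥0∞, ∫⁻ ω, F (cellCount τ m ω) ∂μ =
      ∫⁻ n, F n ∂Measure.pi fun _ => poissonMeasure r := fun F => by
    rw [← hτ.map_cellCount m, lintegral_map (measurable_of_countable _)
      (hτ.measurable_cellCount m)]
  have hcell : ∀ k (hk : k ∈ cellRange R m),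
      ∫⁻ ω, (natCount τ (dyadicCell m k) ω : ℝ≥0∞) * G (cellStat h m (cellCount τ m ω)) ∂μ =
      r * ∫⁻ ω, G (cellStat h m (cellCount τ m ω) + fun j => h j (k / 2 ^ m)) ∂μ := by
    intro k hk
    have h1 := hlaw fun n => (n ⟨k, hsub hk⟩ : ℝ≥0∞) * G (cellStat h m n)
    have h2 := hlaw fun n => G (cellStat h m (n + Pi.single (⟨k, hsub hk⟩ : cellRange m m) 1))
    rw [lintegral_mul_pi_poissonMeasure, ← h2] at h1
    simp only [cellStat_add_single] at h1
    exact h1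
  calc ∫⁻ ω, (natCount τ (Ico (-(R : ℝ)) R) ω : ℝ≥0∞) * G (cellStat h m (cellCount τ m ω)) ∂μ
      = ∫⁻ ω, ∑ k ∈ cellRange R m, (natCount τ (dyadicCell m k) ω : ℝ≥0∞) *
          G (cellStat h m (cellCount τ m ω)) ∂μ := by
        refine lintegral_congr_ae ?_
        filter_upwards [hτ.ae_summable] with ω hω
        rw [← Finset.sum_mul, ← sum_natCount_cellRange hω R m]
        push_cast
        rfl
    _ = ∑ k ∈ cellRange R m, ∫⁻ ω, (natCount τ (dyadicCell m k) ω : ℝ≥0∞) *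
          G (cellStat h m (cellCount τ m ω)) ∂μ := by
        refine lintegral_finsetSum _ fun k _ => ?_
        refine Measurable.mul ?_ ?_
        · exact (measurable_of_countable _).comp
            (hτ.measurable_natCount (measurableSet_dyadicCell m k))
        · exact (measurable_of_countable fun n => G (cellStat h m n)).comp
            (hτ.measurable_cellCount m)
    _ = ∑ k ∈ cellRange R m,
          r * ∫⁻ ω, G (cellStat h m (cellCount τ m ω) + fun j => h j (k / 2 ^ m)) ∂μ :=
        Finset.sum_congr rfl hcell
    _ = ENNReal.ofReal lam * ∑ k ∈ cellRange R m, ∫⁻ x in dyadicCell m k,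
        ∫⁻ ω, G (cellStat h m (cellCount τ m ω) + fun j => h j (dyadicFloor m x)) ∂μ := by
        rw [Finset.mul_sum]
        refine Finset.sum_congr rfl fun k _ => ?_
        -- The Poisson parameter of a cell is `λ` times its length, and the rounded position is
        -- constant on it, so each term is an integral over the cell.
        rw [setLIntegral_congr_fun (measurableSet_dyadicCell m k) (g := fun _ =>
          ∫⁻ ω, G (cellStat h m (cellCount τ m ω) + fun j => h j (k / 2 ^ m)) ∂μ)
          (fun x hx => by simp only [dyadicFloor_of_mem hx]), setLIntegral_const,
          volume_dyadicCell, hr']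
        ring
    _ = _ := by
        rw [Ico_eq_biUnion_dyadicCell R m, lintegral_biUnion_finset]
        · exact fun j _ k _ hjk => disjoint_dyadicCell m hjk
        · exact fun k _ => measurableSet_dyadicCell m k

/-- The size-bias identity: weighting a linear statistic by the number of points in a window
amounts to adding a point at a uniform position of the window. -/
theorem IsPoissonProcess.lintegral_natCount_mul [Countable ι] [IsProbabilityMeasure μ]
    (hlam : 0 ≤ lam) (hτ : IsPoissonProcess μ lam τ) (hh : IsDecayingFamily h) (R : ℕ)
    {F : (ι → ℝ) → ℝ≥0∞} (hF : Measurable F) :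
    ∫⁻ ω, (natCount τ (Ico (-(R : ℝ)) R) ω : ℝ≥0∞) * F (linearStat h τ ω) ∂μ =
      ENNReal.ofReal lam * ∫⁻ p : ℝ × Ω, F (linearStat h τ p.2 + fun j => h j p.1)
        ∂((volume.restrict (Ico (-(R : ℝ)) R)).prod μ) := by
  set W := Ico (-(R : ℝ)) R with hW
  set d : Ω → ℝ≥0∞ := fun ω => natCount τ W ω with hd
  have hWm : MeasurableSet W := measurableSet_Ico
  have hWv : volume W ≠ ∞ := measure_Ico_lt_top.ne
  have : IsFiniteMeasure (volume.restrict W) := ⟨by simpa using hWv.lt_top⟩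
  have hdm : Measurable d := (measurable_of_countable _).comp (hτ.measurable_natCount hWm)
  have hdint : ∫⁻ ω, d ω ∂μ ≠ ∞ := by
    rw [hτ.lintegral_natCount hWm hWv]
    exact ENNReal.mul_ne_top ENNReal.ofReal_ne_top hWv
  have hhm : Measurable fun (x : ℝ) (j : ι) => h j x :=
    measurable_pi_lambda _ hh.measurable
  have hYm := hτ.aemeasurable_linearStat hh
  have hY1 : AEMeasurable (linearStat h τ) (μ.withDensity d) :=
    hYm.mono_ac (withDensity_absolutelyContinuous _ _)
  have hY2 : AEMeasurable (fun p : ℝ × Ω => linearStat h τ p.2 + fun j => h j p.1)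
      ((volume.restrict W).prod μ) :=
    (hYm.comp_snd).add (hhm.comp measurable_fst).aemeasurable
  have hfin : IsFiniteMeasure (μ.withDensity d) := isFiniteMeasure_withDensity hdint
  have hwd : ∀ {F : (ι → ℝ) → ℝ≥0∞}, Measurable F →
      ∫⁻ ω, F (linearStat h τ ω) ∂μ.withDensity d = ∫⁻ ω, d ω * F (linearStat h τ ω) ∂μ :=
    fun hF => lintegral_withDensity_eq_lintegral_mul₀ hdm.aemeasurable (hF.comp_aemeasurable hYm)
  -- Only bounded continuous functionals pass to the limit `m → ∞`. Stating the identity as an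
  -- equality of finite measures extends it to every measurable `F`, in particular to the
  -- discontinuous crossing counts.
  have key : (μ.withDensity d).map (linearStat h τ) = ENNReal.ofReal lam •
      ((volume.restrict W).prod μ).map (fun p : ℝ × Ω => linearStat h τ p.2 + fun j => h j p.1) := by
    refine ext_of_forall_lintegral_eq_of_IsFiniteMeasure fun G => ?_
    have hG : Measurable fun y => (G y : ℝ≥0∞) :=
      measurable_coe_nnreal_ennreal.comp G.continuous.measurable
    have hGb : ∀ y, (G y : ℝ≥0∞) ≤ (nndist G 0 : ℝ≥0∞) := fun y => by
      exact ENNReal.coe_le_coe.2 (BoundedContinuousFunction.NNReal.upper_bound G _)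
    rw [lintegral_map' hG.aemeasurable hY1, lintegral_smul_measure,
      lintegral_map' hG.aemeasurable hY2,
      hwd hG, smul_eq_mul]
    have lim1 : Filter.Tendsto
        (fun m => ∫⁻ ω, d ω * (G (cellStat h m (cellCount τ m ω)) : ℝ≥0∞) ∂μ) Filter.atTop
        (nhds (∫⁻ ω, d ω * (G (linearStat h τ ω) : ℝ≥0∞) ∂μ)) := by
      refine tendsto_lintegral_of_dominated_convergence (fun ω => d ω * (nndist G 0 : ℝ≥0∞))
        (fun m => hdm.mul (hG.comp ((measurable_cellStat h m).comp (hτ.measurable_cellCount m))))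
        (fun m => Filter.Eventually.of_forall fun ω => mul_le_mul_right (hGb _) _) ?_ ?_
      · rw [lintegral_mul_const _ hdm]
        exact ENNReal.mul_ne_top hdint ENNReal.coe_ne_top
      · filter_upwards [hτ.ae_summable] with ω hω
        refine ENNReal.Tendsto.const_mul ?_ (Or.inr (ENNReal.natCast_ne_top _))
        refine (ENNReal.continuous_coe.tendsto _).comp ((G.continuous.tendsto _).comp ?_)
        exact hh.tendsto_cellStat hω
    have hm2 : ∀ m, Measurable fun p : ℝ × Ω =>
        (G (cellStat h m (cellCount τ m p.2) + fun j => h j (dyadicFloor m p.1)) : ℝ≥0∞) :=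
      fun m => hG.comp ((((measurable_cellStat h m).comp (hτ.measurable_cellCount m)).comp
        measurable_snd).add ((hhm.comp (measurable_dyadicFloor m)).comp measurable_fst))
    have lim2 : Filter.Tendsto (fun m => ∫⁻ p : ℝ × Ω,
          (G (cellStat h m (cellCount τ m p.2) + fun j => h j (dyadicFloor m p.1)) : ℝ≥0∞)
          ∂((volume.restrict W).prod μ)) Filter.atTop
        (nhds (∫⁻ p : ℝ × Ω, (G (linearStat h τ p.2 + fun j => h j p.1) : ℝ≥0∞)
          ∂((volume.restrict W).prod μ))) := by
      refine tendsto_lintegral_of_dominated_convergence (fun _ => (nndist G 0 : ℝ≥0∞)) hm2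
        (fun m => Filter.Eventually.of_forall fun ω => hGb _) ?_ ?_
      · rw [lintegral_const]
        exact ENNReal.mul_ne_top ENNReal.coe_ne_top (measure_ne_top _ _)
      · have hae : ∀ᵐ p : ℝ × Ω ∂((volume.restrict W).prod μ),
            Summable fun i => (1 + τ i p.2 ^ 2)⁻¹ :=
          Measure.quasiMeasurePreserving_snd.ae hτ.ae_summable
        filter_upwards [hae] with p hp
        refine (ENNReal.continuous_coe.tendsto _).comp ((G.continuous.tendsto _).comp ?_)
        refine (hh.tendsto_cellStat hp).add ?_
        exact tendsto_pi_nhds.2 fun j => hh.tendsto j p.1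
    refine tendsto_nhds_unique lim1 ((ENNReal.Tendsto.const_mul lim2
      (Or.inr ENNReal.ofReal_ne_top)).congr' ?_)
    filter_upwards [Filter.eventually_ge_atTop R] with m hm
    rw [lintegral_prod _ (hm2 m).aemeasurable]
    exact (hτ.lintegral_natCount_mul_cellStat hlam hm fun y => (G y : ℝ≥0∞)).symm
  calc ∫⁻ ω, d ω * F (linearStat h τ ω) ∂μ
      = ∫⁻ y, F y ∂(μ.withDensity d).map (linearStat h τ) := by
        rw [lintegral_map' hF.aemeasurable hY1, hwd hF]
    _ = _ := by
        rw [key, lintegral_smul_measure, lintegral_map' hF.aemeasurable hY2, smul_eq_mul]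

end ShotNoise

end

noncomputable section

namespace ShotNoise

/-! ### Derivatives of the Gaussian kernel -/

/-- The polynomial factor of the `k`-th derivative of the Gaussian kernel. -/
def kernelPoly (σ : ℝ) : ℕ → Polynomial ℝ
  | 0 => 1
  | k + 1 => (kernelPoly σ k).derivative - Polynomial.C (1 / σ ^ 2) * Polynomial.X * kernelPoly σ k

/-- The `k`-th derivative of the Gaussian kernel. -/
def kernelDeriv (σ : ℝ) (k : ℕ) (u : ℝ) : ℝ := (kernelPoly σ k).eval u * gaussianKernel σ u

variable {σ : ℝ}

lemma kernelDeriv_zero (u : ℝ) : kernelDeriv σ 0 u = gaussianKernel σ u := by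
  simp [kernelDeriv, kernelPoly]

lemma kernelDeriv_two (hσ : 0 < σ) (u : ℝ) :
    kernelDeriv σ 2 u = (u ^ 2 - σ ^ 2) / σ ^ 4 * gaussianKernel σ u := by
  simp [kernelDeriv, kernelPoly]
  field_simp
  ring_nf
  simp

lemma gaussianKernel_pos (hσ : 0 < σ) (u : ℝ) : 0 < gaussianKernel σ u := by
  unfold gaussianKernel
  positivity

lemma hasDerivAt_gaussianKernel (u : ℝ) :
    HasDerivAt (gaussianKernel σ) (-(u / σ ^ 2) * gaussianKernel σ u) u := by
  unfold gaussianKernel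
  have h1 : HasDerivAt (fun t : ℝ => -t ^ 2 / (2 * σ ^ 2)) (-(2 * u) / (2 * σ ^ 2)) u := by
    have := ((hasDerivAt_pow 2 u).neg).div_const (2 * σ ^ 2)
    simpa using this
  refine (h1.exp.const_mul _).congr_deriv ?_
  have : -(2 * u) / (2 * σ ^ 2) = -(u / σ ^ 2) := by
    rw [neg_div, mul_div_mul_left _ _ two_ne_zero]
  rw [this]
  ring

lemma hasDerivAt_kernelDeriv (k : ℕ) (u : ℝ) :
    HasDerivAt (kernelDeriv σ k) (kernelDeriv σ (k + 1) u) u := by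
  refine (((kernelPoly σ k).hasDerivAt u).mul (hasDerivAt_gaussianKernel u)).congr_deriv ?_
  simp only [kernelDeriv, kernelPoly, Polynomial.eval_sub, Polynomial.eval_mul, Polynomial.eval_C,
    Polynomial.eval_X]
  ring

lemma continuous_kernelDeriv (k : ℕ) : Continuous (kernelDeriv σ k) :=
  continuous_iff_continuousAt.2 fun u => (hasDerivAt_kernelDeriv k u).continuousAt

lemma hasStrictDerivAt_kernelDeriv (k : ℕ) (u : ℝ) :
    HasStrictDerivAt (kernelDeriv σ k) (kernelDeriv σ (k + 1) u) u :=
  hasStrictDerivAt_of_hasDerivAt_of_continuousAt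
    (Filter.Eventually.of_forall fun v => hasDerivAt_kernelDeriv k v)
    (continuous_kernelDeriv (k + 1)).continuousAt

/-- For a monomial, a single term `y ^ n / n!` of the exponential series at `y = u ^ 2 / (2 σ ^ 2)`
beats the power. -/
lemma exists_abs_eval_mul_gaussianKernel_le (hσ : 0 < σ) (P : Polynomial ℝ) :
    ∃ C, ∀ u, |P.eval u * gaussianKernel σ u| ≤ C := by
  induction P using Polynomial.induction_on' with
  | add p q hp hq =>
    obtain ⟨C, hC⟩ := hp
    obtain ⟨D, hD⟩ := hq
    refine ⟨C + D, fun u => ?_⟩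
    rw [Polynomial.eval_add, add_mul]
    exact (abs_add_le _ _).trans (add_le_add (hC u) (hD u))
  | monomial n a =>
    set A := 1 / (σ * Real.sqrt (2 * Real.pi)) with hA
    have hApos : 0 < A := by positivity
    refine ⟨|a| * (1 + n.factorial * (2 * σ ^ 2) ^ n) * A, fun u => ?_⟩
    have hexp : Real.exp (-u ^ 2 / (2 * σ ^ 2)) = (Real.exp (u ^ 2 / (2 * σ ^ 2)))⁻¹ := by
      rw [← Real.exp_neg, neg_div]
    have h1 := Real.pow_div_factorial_le_exp (u ^ 2 / (2 * σ ^ 2)) (by positivity) n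
    have h2 : (1 : ℝ) ≤ Real.exp (u ^ 2 / (2 * σ ^ 2)) := Real.one_le_exp (by positivity)
    have h3 : |u| ^ n ≤ 1 + (u ^ 2) ^ n := by
      rw [← pow_mul, mul_comm, pow_mul, ← sq_abs, abs_pow]
      nlinarith [sq_nonneg (|u| ^ n - 1)]
    have h4 : (u ^ 2) ^ n ≤ n.factorial * (2 * σ ^ 2) ^ n * Real.exp (u ^ 2 / (2 * σ ^ 2)) := by
      rw [div_pow, div_div, div_le_iff₀ (by positivity)] at h1
      linarith
    have h5 : |u| ^ n * Real.exp (-u ^ 2 / (2 * σ ^ 2)) ≤ 1 + n.factorial * (2 * σ ^ 2) ^ n := by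
      rw [hexp, ← div_eq_mul_inv, div_le_iff₀ (Real.exp_pos _)]
      linarith
    rw [Polynomial.eval_monomial, gaussianKernel, ← hA, abs_mul, abs_mul, abs_mul, abs_pow,
      abs_of_pos hApos, abs_of_pos (Real.exp_pos _)]
    calc |a| * |u| ^ n * (A * Real.exp (-u ^ 2 / (2 * σ ^ 2)))
        = |a| * (|u| ^ n * Real.exp (-u ^ 2 / (2 * σ ^ 2))) * A := by ring
      _ ≤ _ := by gcongr

lemma exists_abs_kernelDeriv_le (hσ : 0 < σ) (k : ℕ) :
    ∃ C, 0 ≤ C ∧ ∀ u, |kernelDeriv σ k u| ≤ C * (1 + u ^ 2)⁻¹ := by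
  obtain ⟨C, hC⟩ := exists_abs_eval_mul_gaussianKernel_le hσ
    ((1 + Polynomial.X ^ 2) * kernelPoly σ k)
  refine ⟨C, (abs_nonneg _).trans (hC 0), fun u => ?_⟩
  have hpos : (0 : ℝ) < 1 + u ^ 2 := by positivity
  rw [← div_eq_mul_inv, le_div_iff₀ hpos]
  have := hC u
  simp only [Polynomial.eval_mul, Polynomial.eval_add, Polynomial.eval_one, Polynomial.eval_pow,
    Polynomial.eval_X, mul_assoc] at this
  rw [abs_mul, abs_of_pos hpos, mul_comm] at this
  exact this

/-- Separating `t` from `s` in the bound yields domination locally uniform in `t`, as termwise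
differentiation of the path requires. -/
lemma exists_abs_kernelDeriv_sub_le (hσ : 0 < σ) (k : ℕ) :
    ∃ C, 0 ≤ C ∧ ∀ t s, |kernelDeriv σ k (t - s)| ≤ C * (1 + t ^ 2) * (1 + s ^ 2)⁻¹ := by
  obtain ⟨C, hC0, hC⟩ := exists_abs_kernelDeriv_le hσ k
  refine ⟨C * 2, by positivity, fun t s => (hC _).trans ?_⟩
  have : (1 + (t - s) ^ 2)⁻¹ ≤ 2 * (1 + t ^ 2) * (1 + s ^ 2)⁻¹ := by
    rw [← div_eq_mul_inv, le_div_iff₀ (by positivity), inv_mul_le_iff₀ (by positivity)]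
    nlinarith [sq_nonneg (t * (t - s)), sq_nonneg (t + (t - s))]
  calc C * (1 + (t - s) ^ 2)⁻¹ ≤ C * (2 * (1 + t ^ 2) * (1 + s ^ 2)⁻¹) := by gcongr
    _ = _ := by ring

/-! ### Monotonicity of the first derivative of the kernel -/

lemma kernelDeriv_two_pos (hσ : 0 < σ) {u : ℝ} (hu : σ < |u|) : 0 < kernelDeriv σ 2 u := by
  rw [kernelDeriv_two hσ]
  have : σ ^ 2 < u ^ 2 := by
    rw [← sq_abs u]
    gcongr
  exact mul_pos (div_pos (by linarith) (by positivity)) (gaussianKernel_pos hσ u)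

lemma kernelDeriv_two_neg (hσ : 0 < σ) {u : ℝ} (hu : |u| < σ) : kernelDeriv σ 2 u < 0 := by
  rw [kernelDeriv_two hσ]
  have : u ^ 2 < σ ^ 2 := by
    rw [← sq_abs u]
    gcongr
  exact mul_neg_of_neg_of_pos (div_neg_of_neg_of_pos (by linarith) (by positivity))
    (gaussianKernel_pos hσ u)

lemma strictMonoOn_kernelDeriv_Iic (hσ : 0 < σ) : StrictMonoOn (kernelDeriv σ 1) (Iic (-σ)) := by
  refine strictMonoOn_of_deriv_pos (convex_Iic _) (continuous_kernelDeriv 1).continuousOn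
    fun u hu => ?_
  rw [interior_Iic, mem_Iio] at hu
  rw [(hasDerivAt_kernelDeriv 1 u).deriv]
  exact kernelDeriv_two_pos hσ (by rw [abs_of_neg (by linarith)]; linarith)

lemma strictMonoOn_kernelDeriv_Ici (hσ : 0 < σ) : StrictMonoOn (kernelDeriv σ 1) (Ici σ) := by
  refine strictMonoOn_of_deriv_pos (convex_Ici _) (continuous_kernelDeriv 1).continuousOn
    fun u hu => ?_
  rw [interior_Ici, mem_Ioi] at hu
  rw [(hasDerivAt_kernelDeriv 1 u).deriv]
  exact kernelDeriv_two_pos hσ (by rwa [abs_of_pos (by linarith)])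

lemma strictAntiOn_kernelDeriv_Icc (hσ : 0 < σ) :
    StrictAntiOn (kernelDeriv σ 1) (Icc (-σ) σ) := by
  refine strictAntiOn_of_deriv_neg (convex_Icc _ _) (continuous_kernelDeriv 1).continuousOn
    fun u hu => ?_
  rw [interior_Icc, mem_Ioo] at hu
  rw [(hasDerivAt_kernelDeriv 1 u).deriv]
  exact kernelDeriv_two_neg hσ (abs_lt.2 hu)

/-- If the level sets of `f` at the two extreme levels of the kernel derivative are countable, then
for almost every `x` the function `f + g_σ' (· - x)` has no multiple zero in `[0, 1]`. -/
lemma volume_tangential_eq_zero (hσ : 0 < σ) {f f' : ℝ → ℝ} (hf : ∀ t, HasDerivAt f (f' t) t)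
    (h1 : {t | t ∈ Icc (0 : ℝ) 1 ∧ f t = -kernelDeriv σ 1 σ}.Countable)
    (h2 : {t | t ∈ Icc (0 : ℝ) 1 ∧ f t = -kernelDeriv σ 1 (-σ)}.Countable) :
    volume {x | ∃ t ∈ Icc (0 : ℝ) 1, f t + kernelDeriv σ 1 (t - x) = 0 ∧
      f' t + kernelDeriv σ 2 (t - x) = 0} = 0 := by
  have hst := fun u => hasStrictDerivAt_kernelDeriv (σ := σ) 1 u
  have n1 := volume_tangential_branch hf hst isOpen_Iio
    ((strictMonoOn_kernelDeriv_Iic hσ).injOn.mono Iio_subset_Iic_self)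
    (fun u hu => (kernelDeriv_two_pos hσ (by
      have : u < -σ := hu
      rw [abs_of_neg (by linarith)]; linarith)).ne')
  have n2 := volume_tangential_branch hf hst isOpen_Ioo
    ((strictAntiOn_kernelDeriv_Icc hσ).injOn.mono Ioo_subset_Icc_self)
    (fun u hu => (kernelDeriv_two_neg hσ (abs_lt.2 hu)).ne)
  have n3 := volume_tangential_branch hf hst isOpen_Ioi
    ((strictMonoOn_kernelDeriv_Ici hσ).injOn.mono Ioi_subset_Ici_self)
    (fun u hu => (kernelDeriv_two_pos hσ (by
      have : σ < u := hu
      rwa [abs_of_pos (by linarith)])).ne')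
  -- At the critical points `u = ±σ` of the kernel derivative the Sard argument is unavailable.
  -- There the position is `x = t ∓ σ` with `t` on a countable level set of `f`.
  have n4 := (h1.image fun t => t - σ).measure_zero volume
  have n5 := (h2.image fun t => t + σ).measure_zero volume
  refine measure_mono_null ?_ (measure_union_null (measure_union_null (measure_union_null
    (measure_union_null n1 n2) n3) n4) n5)
  rintro x ⟨t, ht, e1, e2⟩
  rcases lt_trichotomy (t - x) (-σ) with h | h | h
  · exact Or.inl (Or.inl (Or.inl (Or.inl ⟨t, h, e1, e2⟩)))
  · right
    rw [h] at e1
    exact ⟨t, ⟨ht, by linarith⟩, by simp only; linarith⟩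
  · rcases lt_trichotomy (t - x) σ with h' | h' | h'
    · exact Or.inl (Or.inl (Or.inl (Or.inr ⟨t, ⟨h, h'⟩, e1, e2⟩)))
    · left; right
      rw [h'] at e1
      exact ⟨t, ⟨ht, by linarith⟩, by simp only; linarith⟩
    · exact Or.inl (Or.inl (Or.inr ⟨t, h', e1, e2⟩))

/-! ### Regularity of the sample paths -/

/-- The `k`-th derivative of the shot noise path with points `x i`. -/
def pathDeriv (σ : ℝ) (k : ℕ) (x : ℕ → ℝ) (t : ℝ) : ℝ := ∑' i, kernelDeriv σ k (t - x i)

variable {x : ℕ → ℝ}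

lemma summable_kernelDeriv (hσ : 0 < σ) (hx : Summable fun i => (1 + x i ^ 2)⁻¹) (k : ℕ) (t : ℝ) :
    Summable fun i => kernelDeriv σ k (t - x i) := by
  obtain ⟨C, -, hC⟩ := exists_abs_kernelDeriv_sub_le hσ k
  exact Summable.of_norm_bounded (hx.mul_left (C * (1 + t ^ 2))) fun i => hC t (x i)

lemma hasDerivAt_pathDeriv (hσ : 0 < σ) (hx : Summable fun i => (1 + x i ^ 2)⁻¹) (k : ℕ) (t : ℝ) :
    HasDerivAt (pathDeriv σ k x) (pathDeriv σ (k + 1) x t) t := by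
  obtain ⟨C, hC0, hC⟩ := exists_abs_kernelDeriv_sub_le hσ (k + 1)
  refine hasDerivAt_tsum_of_isPreconnected
    (g := fun i s => kernelDeriv σ k (s - x i)) (g' := fun i s => kernelDeriv σ (k + 1) (s - x i))
    (t := Ioo (t - 1) (t + 1)) (y₀ := t)
    (u := fun i => C * (1 + (|t| + 1) ^ 2) * (1 + x i ^ 2)⁻¹)
    (hx.mul_left _) isOpen_Ioo isPreconnected_Ioo (fun i s _ => ?_) (fun i s hs => ?_)
    ⟨by linarith, by linarith⟩ (summable_kernelDeriv hσ hx k t) ⟨by linarith, by linarith⟩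
  · simpa using (hasDerivAt_kernelDeriv k (s - x i)).comp_sub_const s (x i)
  · refine (hC s (x i)).trans ?_
    have : s ^ 2 ≤ (|t| + 1) ^ 2 := by
      rw [← sq_abs s]
      have : |s| ≤ |t| + 1 := by
        rw [abs_le]
        constructor <;> linarith [hs.1, hs.2, neg_abs_le t, le_abs_self t]
      gcongr
    gcongr

lemma continuous_pathDeriv (hσ : 0 < σ) (hx : Summable fun i => (1 + x i ^ 2)⁻¹) (k : ℕ) :
    Continuous (pathDeriv σ k x) :=
  continuous_iff_continuousAt.2 fun t => (hasDerivAt_pathDeriv hσ hx k t).continuousAt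

lemma deriv_pathDeriv (hσ : 0 < σ) (hx : Summable fun i => (1 + x i ^ 2)⁻¹) (k : ℕ) :
    deriv (pathDeriv σ k x) = pathDeriv σ (k + 1) x :=
  funext fun t => (hasDerivAt_pathDeriv hσ hx k t).deriv

lemma contDiff_pathDeriv (hσ : 0 < σ) (hx : Summable fun i => (1 + x i ^ 2)⁻¹) (n k : ℕ) :
    ContDiff ℝ n (pathDeriv σ k x) := by
  induction n generalizing k with
  | zero => exact contDiff_zero.2 (continuous_pathDeriv hσ hx k)
  | succ n ih =>
    have : ((n + 1 : ℕ) : WithTop ℕ∞) = n + 1 := by norm_cast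
    rw [this, contDiff_succ_iff_deriv]
    refine ⟨fun t => (hasDerivAt_pathDeriv hσ hx k t).differentiableAt, by simp, ?_⟩
    rw [deriv_pathDeriv hσ hx]
    exact ih (k + 1)

lemma shotNoise_eq_pathDeriv {Ω : Type*} (τ : ℕ → Ω → ℝ) (ω : Ω) :
    shotNoise σ τ ω = pathDeriv σ 0 (fun i => τ i ω) := by
  ext t
  simp only [shotNoise, pathDeriv, kernelDeriv_zero]

/-- If there is no point close to `[0, 1]`, the path is strictly convex on `[0, 1]`. -/
lemma crossingCount_pathDeriv_one_le (hσ : 0 < σ) (hx : Summable fun i => (1 + x i ^ 2)⁻¹) {R : ℝ}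
    (hR : 1 + σ < R) (hempty : ∀ i, x i ∉ Ico (-R) R) (c : ℝ) :
    crossingCount (pathDeriv σ 1 x) c 0 1 ≤ 1 := by
  -- Every point is farther than `σ` from `[0, 1]` because `R > 1 + σ`, so every term of the second
  -- derivative is positive.
  have hpos : ∀ t ∈ Icc (0 : ℝ) 1, 0 < pathDeriv σ 2 x t := by
    intro t ht
    have hterm : ∀ i, 0 < kernelDeriv σ 2 (t - x i) := by
      intro i
      refine kernelDeriv_two_pos hσ ?_
      rcases lt_or_ge (x i) (-R) with h | h
      · exact lt_of_lt_of_le (by linarith [ht.1]) (le_abs_self _)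
      · have h' : R ≤ x i := by
          by_contra hlt
          exact hempty i ⟨h, not_le.1 hlt⟩
        exact lt_of_lt_of_le (by linarith [ht.2]) (neg_le_abs _)
    exact (summable_kernelDeriv hσ hx 2 t).tsum_pos (fun i => (hterm i).le) 0 (hterm 0)
  have hmono : StrictMonoOn (pathDeriv σ 1 x) (Icc 0 1) := by
    refine strictMonoOn_of_deriv_pos (convex_Icc _ _) (continuous_pathDeriv hσ hx 1).continuousOn
      fun t ht => ?_
    rw [deriv_pathDeriv hσ hx]
    exact hpos t (interior_subset ht)
  refine encard_le_one_iff.2 fun a b ha hb => ?_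
  exact hmono.injOn ha.1 hb.1 (ha.2.trans hb.2.symm)

/-! ### The family of statistics describing the path -/

/-- The functions of a point giving the derivatives of the path at rational times, together with
the indicator function of a window. -/
def pathFamily (σ : ℝ) (R : ℕ) : Option (ℕ × ℚ) → ℝ → ℝ
  | none => (Ico (-(R : ℝ)) R).indicator 1
  | some (k, q) => fun s => kernelDeriv σ k (q - s)

/-- The window indicator is discontinuous, yet it is constant along the dyadic roundings of a point
because `±R` are dyadic. Approximation along `dyadicFloor` is thus all that can be asked of the
family. -/
lemma isDecayingFamily_pathFamily (hσ : 0 < σ) (R : ℕ) : IsDecayingFamily (pathFamily σ R) where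
  measurable
    | none => measurable_one.indicator measurableSet_Ico
    | some (k, q) => ((continuous_kernelDeriv k).comp (continuous_const.sub continuous_id)).measurable
  decay
    | none => by
      refine ⟨1 + R ^ 2, fun s => ?_⟩
      simp only [pathFamily]
      by_cases hs : s ∈ Ico (-(R : ℝ)) R
      · rw [indicator_of_mem hs, Pi.one_apply, abs_one, ← div_eq_mul_inv, le_div_iff₀ (by positivity)]
        nlinarith [hs.1, hs.2]
      · rw [indicator_of_notMem hs, abs_zero]
        positivity
    | some (k, q) => by
      obtain ⟨C, -, hC⟩ := exists_abs_kernelDeriv_sub_le hσ k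
      exact ⟨C * (1 + (q : ℝ) ^ 2), fun s => hC q s⟩
  tendsto
    | none => fun s => by
      have : ∀ m, dyadicFloor m s ∈ Ico (-(R : ℝ)) R ↔ s ∈ Ico (-(R : ℝ)) R := fun m => by
        rw [← floor_mem_cellRange (m := m), ← floor_mem_cellRange (m := m) (s := s), dyadicFloor,
          mul_div_cancel₀ _ (by positivity), Int.floor_intCast]
      simp only [pathFamily, indicator_apply, this]
      exact tendsto_const_nhds
    | some (k, q) => fun s =>
      (((continuous_kernelDeriv k).comp (continuous_const.sub continuous_id)).tendsto s).comp
        (tendsto_dyadicFloor s)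

variable {Ω : Type*} {τ : ℕ → Ω → ℝ}

lemma linearStat_pathFamily_none {ω : Ω} (hω : Summable fun i => (1 + τ i ω ^ 2)⁻¹) (R : ℕ) :
    linearStat (pathFamily σ R) τ ω none = natCount τ (Ico (-(R : ℝ)) R) ω :=
  (natCount_eq_tsum hω (Metric.isBounded_Ico _ _)).symm

lemma linearStat_pathFamily_some (ω : Ω) (R k : ℕ) (q : ℚ) :
    linearStat (pathFamily σ R) τ ω (some (k, q)) = pathDeriv σ k (fun i => τ i ω) q := rfl

end ShotNoise

end

noncomputable section

namespace ShotNoise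

variable {Ω : Type*} {lam σ : ℝ} {τ : ℕ → Ω → ℝ}

/-! ### The mean number of crossings of the derivative -/

lemma crossingCount_add_const (f : ℝ → ℝ) (d c a b : ℝ) :
    crossingCount (fun t => f t + d) c a b = crossingCount f (c - d) a b := by
  unfold crossingCount
  congr 1
  ext t
  simp only [mem_ofPred_eq, eq_sub_iff_add_eq]

/-- The number of crossings of the level `c` by the `k`-th derivative of the path, on the event
that the window contains `n` points, as a functional of the statistics of the path. -/
def windowCount (k n : ℕ) (c : ℝ) (y : Option (ℕ × ℚ) → ℝ) : ℝ≥0∞ :=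
  if y none = n then (ratCount c (fun q => y (some (k, q))) : ℝ≥0∞) else 0

lemma measurable_ratCount_ennreal (c : ℝ) : Measurable fun y => (ratCount c y : ℝ≥0∞) :=
  measurable_enat_iff.1 (measurable_ratCount c)

lemma measurable_windowCount (k n : ℕ) (c : ℝ) : Measurable (windowCount k n c) := by
  refine Measurable.ite ?_ ?_ measurable_const
  · exact measurableSet_eq_fun (measurable_pi_apply none) measurable_const
  · exact (measurable_ratCount_ennreal c).comp
      (measurable_pi_lambda _ fun q => measurable_pi_apply _)

lemma ratCount_linearStat (hσ : 0 < σ) {ω : Ω} (hω : Summable fun i => (1 + τ i ω ^ 2)⁻¹)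
    (R k : ℕ) (c : ℝ) :
    ratCount c (fun q => linearStat (pathFamily σ R) τ ω (some (k, q))) =
      crossingCount (pathDeriv σ k (fun i => τ i ω)) c 0 1 := by
  simp only [linearStat_pathFamily_some]
  exact ratCount_eq (continuous_pathDeriv hσ hω k) c

lemma windowCount_linearStat (hσ : 0 < σ) {ω : Ω} (hω : Summable fun i => (1 + τ i ω ^ 2)⁻¹)
    (R k n : ℕ) (c : ℝ) :
    windowCount k n c (linearStat (pathFamily σ R) τ ω) =
      if natCount τ (Ico (-(R : ℝ)) R) ω = n then
        (crossingCount (pathDeriv σ k (fun i => τ i ω)) c 0 1 : ℝ≥0∞) else 0 := by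
  simp only [windowCount, linearStat_pathFamily_none hω, Nat.cast_inj, ratCount_linearStat hσ hω]

/-- A point added inside the window raises its count by one, so the event `n + 1` becomes the event
`n` for the original configuration. -/
lemma windowCount_linearStat_add (hσ : 0 < σ) {ω : Ω}
    (hω : Summable fun i => (1 + τ i ω ^ 2)⁻¹) (R k n : ℕ) (c : ℝ) {x : ℝ}
    (hx : x ∈ Ico (-(R : ℝ)) R) :
    windowCount k (n + 1) c (linearStat (pathFamily σ R) τ ω + fun j => pathFamily σ R j x) =
      if natCount τ (Ico (-(R : ℝ)) R) ω = n then
        (crossingCount (fun t => pathDeriv σ k (fun i => τ i ω) t + kernelDeriv σ k (t - x)) c 0 1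
          : ℝ≥0∞) else 0 := by
  have h1 : (linearStat (pathFamily σ R) τ ω + fun j => pathFamily σ R j x) none =
      (natCount τ (Ico (-(R : ℝ)) R) ω : ℝ) + 1 := by
    rw [Pi.add_apply, linearStat_pathFamily_none hω]
    simp [pathFamily, hx.1, hx.2]
  have h2 : Continuous fun t => pathDeriv σ k (fun i => τ i ω) t + kernelDeriv σ k (t - x) :=
    (continuous_pathDeriv hσ hω k).add
      ((continuous_kernelDeriv k).comp (continuous_id.sub continuous_const))
  have h3 : (fun q : ℚ => (linearStat (pathFamily σ R) τ ω + fun j => pathFamily σ R j x)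
      (some (k, q))) = fun q : ℚ => pathDeriv σ k (fun i => τ i ω) q + kernelDeriv σ k (q - x) := rfl
  rw [windowCount, h1, h3, ratCount_eq h2]
  simp only [Nat.cast_add, Nat.cast_one, add_left_inj, Nat.cast_inj]

/-- The crossings of `y + φ u` on the event that the window contains `n` points. -/
def shiftedWindowCount (φ : ℝ → ℝ) (n : ℕ) (c : ℝ) (p : (Option (ℕ × ℚ) → ℝ) × ℝ) : ℝ≥0∞ :=
  if p.1 none = n then (ratCount c (fun q => p.1 (some (1, q)) + φ p.2) : ℝ≥0∞) else 0

lemma measurable_shiftedWindowCount {φ : ℝ → ℝ} (hφ : Continuous φ) (n : ℕ) (c : ℝ) :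
    Measurable (shiftedWindowCount φ n c) := by
  have hn : Measurable fun p : (Option (ℕ × ℚ) → ℝ) × ℝ => p.1 none :=
    (measurable_pi_apply none).comp measurable_fst
  refine Measurable.ite (measurableSet_eq_fun hn measurable_const) ?_ measurable_const
  refine (measurable_ratCount_ennreal c).comp (measurable_pi_lambda _ fun q => ?_)
  exact ((measurable_pi_apply _).comp measurable_fst).add (hφ.measurable.comp measurable_snd)

lemma shiftedWindowCount_linearStat (hσ : 0 < σ) {ω : Ω}
    (hω : Summable fun i => (1 + τ i ω ^ 2)⁻¹) (R n : ℕ) (c u : ℝ) (φ : ℝ → ℝ) :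
    shiftedWindowCount φ n c (linearStat (pathFamily σ R) τ ω, u) =
      if natCount τ (Ico (-(R : ℝ)) R) ω = n then
        (crossingCount (fun t => pathDeriv σ 1 (fun i => τ i ω) t + φ u) c 0 1 : ℝ≥0∞) else 0 := by
  have h2 : Continuous fun t => pathDeriv σ 1 (fun i => τ i ω) t + φ u :=
    (continuous_pathDeriv hσ hω 1).add continuous_const
  simp only [shiftedWindowCount, linearStat_pathFamily_none hω, linearStat_pathFamily_some,
    Nat.cast_inj]
  rw [ratCount_eq h2]

variable [MeasurableSpace Ω] {μ : Measure Ω}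

/-- The mean number of crossings of the level `c` by the derivative of the path on the event that
the window `[-R, R)` contains `n` points. -/
def meanWindowCount (μ : Measure Ω) (σ : ℝ) (τ : ℕ → Ω → ℝ) (R n : ℕ) (c : ℝ) : ℝ≥0∞ :=
  ∫⁻ ω, windowCount 1 n c (linearStat (pathFamily σ R) τ ω) ∂μ

/-- The recursion in the number of points. On the event of `n + 1` points the factor `n + 1` is the
window count, so size bias applies, followed pathwise by the translation estimate. The interval
`[-R, R + 1]` contains all differences `t - x` with `t ∈ [0, 1]`, `x ∈ [-R, R)`. -/
lemma succ_mul_meanWindowCount_le [IsProbabilityMeasure μ] (hlam : 0 ≤ lam) (hσ : 0 < σ)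
    (hτ : IsPoissonProcess μ lam τ) (R n : ℕ) (c : ℝ) :
    ((n + 1 : ℕ) : ℝ≥0∞) * meanWindowCount μ σ τ R (n + 1) c ≤
      ENNReal.ofReal lam * (3 * μ {ω | natCount τ (Ico (-(R : ℝ)) R) ω = n} +
        ∫⁻ u in Icc (-(R : ℝ)) (R + 1), meanWindowCount μ σ τ R n (c - kernelDeriv σ 1 u)) := by
  classical
  set W := Ico (-(R : ℝ)) R with hW
  set V := Icc (-(R : ℝ)) (R + 1) with hV
  set h := pathFamily σ R with hh
  have hdec : IsDecayingFamily h := isDecayingFamily_pathFamily hσ R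
  have hYm := hτ.aemeasurable_linearStat hdec
  have hN : MeasurableSet {ω | natCount τ W ω = n} :=
    hτ.measurable_natCount measurableSet_Ico (measurableSet_singleton n)
  have hφ := continuous_kernelDeriv (σ := σ) 1
  have hQ := measurable_shiftedWindowCount hφ n c
  have hbranch := fun (f : ℝ → ℝ) (hf : Continuous f) =>
    lintegral_crossingCount_translate_le (V := V) (W := W) hf hφ
      (.of_monotoneOn ordConnected_Iio
        ((strictMonoOn_kernelDeriv_Iic hσ).monotoneOn.mono Iio_subset_Iic_self))
      (.of_antitoneOn ordConnected_Icc (strictAntiOn_kernelDeriv_Icc hσ).antitoneOn)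
      (.of_monotoneOn ordConnected_Ioi
        ((strictMonoOn_kernelDeriv_Ici hσ).monotoneOn.mono Ioi_subset_Ici_self)) hσ
      measurableSet_Ico ordConnected_Icc (Metric.isBounded_Icc _ _)
      (fun x hx t ht => ⟨by linarith [hx.2, ht.1], by linarith [hx.1, ht.2]⟩) c
  calc ((n + 1 : ℕ) : ℝ≥0∞) * meanWindowCount μ σ τ R (n + 1) c
      = ∫⁻ ω, (natCount τ W ω : ℝ≥0∞) * windowCount 1 (n + 1) c (linearStat h τ ω) ∂μ := by
        have hwm : AEMeasurable (fun ω => windowCount 1 (n + 1) c (linearStat h τ ω)) μ :=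
          (measurable_windowCount 1 (n + 1) c).comp_aemeasurable hYm
        rw [meanWindowCount, ← lintegral_const_mul'' _ hwm]
        refine lintegral_congr_ae ?_
        filter_upwards [hτ.ae_summable] with ω hω
        simp only [windowCount_linearStat hσ hω, hh]
        split_ifs with hn
        · rw [hn]
        · simp
    _ = ENNReal.ofReal lam * ∫⁻ p : ℝ × Ω, windowCount 1 (n + 1) c
          (linearStat h τ p.2 + fun j => h j p.1) ∂((volume.restrict W).prod μ) :=
        hτ.lintegral_natCount_mul hlam hdec R (measurable_windowCount 1 (n + 1) c)
    _ = ENNReal.ofReal lam * ∫⁻ ω, (∫⁻ x in W, windowCount 1 (n + 1) c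
          (linearStat h τ ω + fun j => h j x)) ∂μ := by
        rw [lintegral_prod_symm]
        refine (measurable_windowCount 1 (n + 1) c).comp_aemeasurable ?_
        exact (hYm.comp_snd).add
          ((measurable_pi_lambda _ hdec.measurable).comp measurable_fst).aemeasurable
    _ ≤ ENNReal.ofReal lam * ∫⁻ ω, ({ω | natCount τ W ω = n}.indicator (fun _ => 3) ω +
          ∫⁻ u in V, shiftedWindowCount (kernelDeriv σ 1) n c (linearStat h τ ω, u)) ∂μ := by
        refine mul_le_mul_right (lintegral_mono_ae ?_) _
        filter_upwards [hτ.ae_summable] with ω hω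
        rw [setLIntegral_congr_fun measurableSet_Ico
          (fun x hx => windowCount_linearStat_add hσ hω R 1 n c hx)]
        simp only [hh, shiftedWindowCount_linearStat hσ hω, indicator_apply, mem_ofPred_eq, ← hW]
        split_ifs
        · exact hbranch _ (continuous_pathDeriv hσ hω 1)
        · simp
    _ = ENNReal.ofReal lam * (3 * μ {ω | natCount τ W ω = n} +
          ∫⁻ ω, (∫⁻ u in V,
            shiftedWindowCount (kernelDeriv σ 1) n c (linearStat h τ ω, u)) ∂μ) := by
        rw [lintegral_add_left (measurable_const.indicator hN), lintegral_indicator_const hN]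
    _ = _ := by
        congr 2
        -- For fixed `u`, the constant `φ u` only shifts the level, so the inner mean is again of
        -- the form bounded by induction, at another level.
        rw [lintegral_lintegral_swap]
        · refine lintegral_congr fun u => lintegral_congr_ae ?_
          filter_upwards [hτ.ae_summable] with ω hω
          simp only [hh, shiftedWindowCount_linearStat hσ hω, windowCount_linearStat hσ hω,
            crossingCount_add_const]
        · exact hQ.comp_aemeasurable ((hYm.comp_fst).prodMk measurable_snd.aemeasurable)

lemma meanWindowCount_zero_le [IsProbabilityMeasure μ] (hσ : 0 < σ)
    (hτ : IsPoissonProcess μ lam τ) {R : ℕ} (hR : 1 + σ < R) (c : ℝ) :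
    meanWindowCount μ σ τ R 0 c ≤ μ {ω | natCount τ (Ico (-(R : ℝ)) R) ω = 0} := by
  classical
  have hN : MeasurableSet {ω | natCount τ (Ico (-(R : ℝ)) R) ω = 0} :=
    hτ.measurable_natCount measurableSet_Ico (measurableSet_singleton 0)
  rw [← lintegral_indicator_one hN]
  refine lintegral_mono_ae ?_
  filter_upwards [hτ.ae_summable] with ω hω
  simp only [windowCount_linearStat hσ hω, indicator_apply, mem_ofPred_eq, Pi.one_apply]
  split_ifs with h0
  · have hfin := finite_mem_of_summable hω (Metric.isBounded_Ico (-(R : ℝ)) R)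
    have hempty : ∀ i, τ i ω ∉ Ico (-(R : ℝ)) R := by
      rw [natCount, pointCount, hfin.encard_eq_coe_toFinset_card, ENat.toNat_natCast,
        Finset.card_eq_zero, hfin.toFinset_eq_empty] at h0
      intro i hi
      have : i ∈ {i | τ i ω ∈ Ico (-(R : ℝ)) R} := hi
      rw [h0] at this
      exact this
    have := crossingCount_pathDeriv_one_le hσ hω hR hempty c
    calc (crossingCount (pathDeriv σ 1 (fun i => τ i ω)) c 0 1 : ℝ≥0∞) ≤ ((1 : ℕ∞) : ℝ≥0∞) :=
          ENat.toENNReal_le.2 this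
      _ = 1 := ENat.toENNReal_one
  · exact le_rfl

lemma measure_natCount_eq (hτ : IsPoissonProcess μ lam τ) (R n : ℕ) :
    μ {ω | natCount τ (Ico (-(R : ℝ)) R) ω = n} =
      poissonMeasure (lam * (2 * R)).toNNReal {n} := by
  have h := hτ.map_natCount (B := Ico (-(R : ℝ)) R) measurableSet_Ico measure_Ico_lt_top.ne
  have hv : volume.real (Ico (-(R : ℝ)) R) = 2 * R := by
    rw [Real.volume_real_Ico_of_le (by linarith [Nat.cast_nonneg (α := ℝ) R])]
    ring
  rw [hv] at h
  rw [← h, Measure.map_apply (hτ.measurable_natCount measurableSet_Ico) (measurableSet_singleton n)]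
  rfl

/-- Adding `3 p n` makes the recursion homogeneous: since `(n + 1) p (n + 1) = 2 λ R p n`, the terms
`3 p n + 3 * 2R * p n` equal the integral of `3 p n` over an interval of length `2R + 1`. The
induction needs all levels `c` at once. -/
lemma meanWindowCount_add_le [IsProbabilityMeasure μ] (hlam : 0 ≤ lam) (hσ : 0 < σ)
    (hτ : IsPoissonProcess μ lam τ) {R : ℕ} (hR : 1 + σ < R) (n : ℕ) (c : ℝ) :
    meanWindowCount μ σ τ R n c + 3 * μ {ω | natCount τ (Ico (-(R : ℝ)) R) ω = n} ≤
      4 * ENNReal.ofReal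
        (Real.exp (-(lam * (2 * R))) * ((lam * (2 * R + 1)) ^ n / n.factorial)) := by
  have hr : ((lam * (2 * R)).toNNReal : ℝ) = lam * (2 * R) := Real.coe_toNNReal _ (by positivity)
  induction n generalizing c with
  | zero =>
    have h0 := measure_natCount_eq hτ R 0
    rw [poissonMeasure_singleton, hr] at h0
    calc _ ≤ μ {ω | natCount τ (Ico (-(R : ℝ)) R) ω = 0} +
          3 * μ {ω | natCount τ (Ico (-(R : ℝ)) R) ω = 0} :=
          add_le_add_left (meanWindowCount_zero_le hσ hτ hR c) _
      _ = 4 * μ {ω | natCount τ (Ico (-(R : ℝ)) R) ω = 0} := by ring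
      _ = _ := by
        rw [h0]
        simp
  | succ n ih =>
    set p : ℕ → ℝ≥0∞ := fun n => μ {ω | natCount τ (Ico (-(R : ℝ)) R) ω = n} with hp
    set b : ℕ → ℝ≥0∞ := fun n => ENNReal.ofReal
        (Real.exp (-(lam * (2 * R))) * ((lam * (2 * R + 1)) ^ n / n.factorial)) with hb
    have hpn : ((n + 1 : ℕ) : ℝ≥0∞) * p (n + 1) =
        ENNReal.ofReal lam * ENNReal.ofReal (2 * R) * p n := by
      simp only [hp, measure_natCount_eq hτ]
      rw [succ_mul_poissonMeasure_singleton, ← ENNReal.ofReal_mul hlam]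
      rfl
    have hbn : ((n + 1 : ℕ) : ℝ≥0∞) * b (n + 1) =
        ENNReal.ofReal lam * ENNReal.ofReal (2 * R + 1) * b n := by
      simp only [hb]
      rw [← ENNReal.ofReal_natCast, ← ENNReal.ofReal_mul (by positivity),
        ← ENNReal.ofReal_mul hlam, ← ENNReal.ofReal_mul (by positivity)]
      congr 1
      rw [Nat.factorial_succ, pow_succ]
      push_cast
      have : (n.factorial : ℝ) ≠ 0 := by positivity
      field_simp
    have hvol : volume (Icc (-(R : ℝ)) (R + 1)) = ENNReal.ofReal (2 * R + 1) := by
      rw [Real.volume_Icc]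
      congr 1
      ring
    have hsplit : ENNReal.ofReal (2 * R + 1) = ENNReal.ofReal (2 * R) + 1 := by
      rw [ENNReal.ofReal_add (by positivity) zero_le_one, ENNReal.ofReal_one]
    refine (ENNReal.mul_le_mul_iff_right (a := ((n + 1 : ℕ) : ℝ≥0∞)) (by simp)
      (ENNReal.natCast_ne_top _)).1 ?_
    calc ((n + 1 : ℕ) : ℝ≥0∞) * (meanWindowCount μ σ τ R (n + 1) c + 3 * p (n + 1))
        = ((n + 1 : ℕ) : ℝ≥0∞) * meanWindowCount μ σ τ R (n + 1) c +
            3 * (((n + 1 : ℕ) : ℝ≥0∞) * p (n + 1)) := by ring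
      _ ≤ ENNReal.ofReal lam * (3 * p n +
            ∫⁻ u in Icc (-(R : ℝ)) (R + 1), meanWindowCount μ σ τ R n (c - kernelDeriv σ 1 u)) +
            3 * (ENNReal.ofReal lam * ENNReal.ofReal (2 * R) * p n) := by
          rw [hpn]
          exact add_le_add_left (succ_mul_meanWindowCount_le hlam hσ hτ R n c) _
      _ = ENNReal.ofReal lam * ((∫⁻ u in Icc (-(R : ℝ)) (R + 1),
            meanWindowCount μ σ τ R n (c - kernelDeriv σ 1 u)) +
              3 * p n * ENNReal.ofReal (2 * R + 1)) := by
          rw [hsplit]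
          ring
      _ = ENNReal.ofReal lam * (∫⁻ u in Icc (-(R : ℝ)) (R + 1),
            (meanWindowCount μ σ τ R n (c - kernelDeriv σ 1 u) + 3 * p n)) := by
          rw [lintegral_add_right _ measurable_const, setLIntegral_const, hvol]
      _ ≤ ENNReal.ofReal lam * ∫⁻ _ in Icc (-(R : ℝ)) (R + 1), 4 * b n := by
          gcongr with u
          exact ih _
      _ = 4 * (ENNReal.ofReal lam * ENNReal.ofReal (2 * R + 1) * b n) := by
          rw [setLIntegral_const, hvol]
          ring
      _ = ((n + 1 : ℕ) : ℝ≥0∞) * (4 * b (n + 1)) := by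
          rw [← hbn]
          ring

lemma tsum_ite_natCount (M : ℕ) (a : ℝ≥0∞) : ∑' n, (if M = n then a else 0) = a := by
  rw [tsum_eq_single M (fun n hn => if_neg hn.symm), if_pos rfl]

/-- The mean number of crossings of any level by the derivative of the path in `[0, 1]` is at most
`4 e ^ λ - 3`. -/
theorem lintegral_crossingCount_deriv_add_le [IsProbabilityMeasure μ] (hlam : 0 ≤ lam)
    (hσ : 0 < σ) (hτ : IsPoissonProcess μ lam τ) (c : ℝ) :
    ∫⁻ ω, (crossingCount (pathDeriv σ 1 (fun i => τ i ω)) c 0 1 : ℝ≥0∞) ∂μ + 3 ≤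
      4 * ENNReal.ofReal (Real.exp lam) := by
  obtain ⟨R, hR⟩ := exists_nat_gt (1 + σ)
  have hYm := hτ.aemeasurable_linearStat (isDecayingFamily_pathFamily hσ R)
  have h1 : ∫⁻ ω, (crossingCount (pathDeriv σ 1 (fun i => τ i ω)) c 0 1 : ℝ≥0∞) ∂μ =
      ∑' n, meanWindowCount μ σ τ R n c := by
    unfold meanWindowCount
    have hwm : ∀ n, AEMeasurable
        (fun ω => windowCount 1 n c (linearStat (pathFamily σ R) τ ω)) μ :=
      fun n => (measurable_windowCount 1 n c).comp_aemeasurable hYm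
    rw [← lintegral_tsum hwm]
    refine lintegral_congr_ae ?_
    filter_upwards [hτ.ae_summable] with ω hω
    simp only [windowCount_linearStat hσ hω]
    rw [tsum_ite_natCount]
  have h2 : (1 : ℝ≥0∞) = ∑' n, μ {ω | natCount τ (Ico (-(R : ℝ)) R) ω = n} := by
    have hN := hτ.measurable_natCount (B := Ico (-(R : ℝ)) R) measurableSet_Ico
    rw [← measure_iUnion]
    · rw [← measure_univ (μ := μ)]
      congr 1
      ext ω
      simp
    · intro i j hij
      exact disjoint_left.2 fun ω h1 h2 => hij (h1.symm.trans h2)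
    · exact fun n => hN (measurableSet_singleton n)
  -- The exponents `-2 λ R` and `λ (2R + 1)` add up to `λ`: the auxiliary window disappears.
  have h3 : ∑' n : ℕ, ENNReal.ofReal
      (Real.exp (-(lam * (2 * R))) * ((lam * (2 * R + 1)) ^ n / n.factorial)) =
      ENNReal.ofReal (Real.exp lam) := by
    have hs := (NormedSpace.expSeries_div_hasSum_exp (lam * (2 * R + 1) : ℝ)).mul_left
      (Real.exp (-(lam * (2 * R))))
    rw [← ENNReal.ofReal_tsum_of_nonneg (fun n => by positivity) hs.summable, hs.tsum_eq,
      ← Real.exp_eq_exp_ℝ, ← Real.exp_add]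
    congr 2
    ring
  calc ∫⁻ ω, (crossingCount (pathDeriv σ 1 (fun i => τ i ω)) c 0 1 : ℝ≥0∞) ∂μ + 3
      = ∑' n, (meanWindowCount μ σ τ R n c +
          3 * μ {ω | natCount τ (Ico (-(R : ℝ)) R) ω = n}) := by
        rw [ENNReal.tsum_add, ENNReal.tsum_mul_left, ← h2, h1, mul_one]
    _ ≤ ∑' n : ℕ, 4 * ENNReal.ofReal
        (Real.exp (-(lam * (2 * R))) * ((lam * (2 * R + 1)) ^ n / n.factorial)) :=
        ENNReal.tsum_le_tsum fun n => meanWindowCount_add_le hlam hσ hτ hR n c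
    _ = _ := by rw [ENNReal.tsum_mul_left, h3]

end ShotNoise

end

noncomputable section

namespace ShotNoise

variable {Ω : Type*} [MeasurableSpace Ω] {μ : Measure Ω} {lam σ : ℝ} {τ : ℕ → Ω → ℝ}

/-! ### Measurability and almost sure finiteness of the crossing counts -/

lemma measurable_ratCount_coord (k : ℕ) (c : ℝ) :
    Measurable fun y : Option (ℕ × ℚ) → ℝ => ratCount c (fun q => y (some (k, q))) :=
  (measurable_ratCount c).comp (measurable_pi_lambda _ fun _ => measurable_pi_apply _)

lemma IsPoissonProcess.aemeasurable_crossingCount (hσ : 0 < σ) (hτ : IsPoissonProcess μ lam τ)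
    (k : ℕ) (c : ℝ) :
    AEMeasurable (fun ω => crossingCount (pathDeriv σ k (fun i => τ i ω)) c 0 1) μ := by
  have hYm := hτ.aemeasurable_linearStat (isDecayingFamily_pathFamily hσ 0)
  have h : AEMeasurable (fun ω => ratCount c
      (fun q => linearStat (pathFamily σ 0) τ ω (some (k, q)))) μ :=
    (measurable_ratCount_coord k c).comp_aemeasurable hYm
  refine h.congr ?_
  filter_upwards [hτ.ae_summable] with ω hω
  exact ratCount_linearStat hσ hω 0 k c

lemma _root_.AEMeasurable.enat_toENNReal {f : Ω → ℕ∞} (hf : AEMeasurable f μ) :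
    AEMeasurable (fun ω => (f ω : ℝ≥0∞)) μ :=
  (measurable_of_countable _).comp_aemeasurable hf

lemma lintegral_crossingCount_deriv_lt_top [IsProbabilityMeasure μ] (hlam : 0 ≤ lam) (hσ : 0 < σ)
    (hτ : IsPoissonProcess μ lam τ) (c : ℝ) :
    ∫⁻ ω, (crossingCount (pathDeriv σ 1 (fun i => τ i ω)) c 0 1 : ℝ≥0∞) ∂μ < ∞ :=
  (le_self_add.trans (lintegral_crossingCount_deriv_add_le hlam hσ hτ c)).trans_lt
    (ENNReal.mul_lt_top (by simp) ENNReal.ofReal_lt_top)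

lemma ae_countable_crossing_deriv [IsProbabilityMeasure μ] (hlam : 0 ≤ lam) (hσ : 0 < σ)
    (hτ : IsPoissonProcess μ lam τ) (c : ℝ) :
    ∀ᵐ ω ∂μ, {t | t ∈ Icc (0 : ℝ) 1 ∧ pathDeriv σ 1 (fun i => τ i ω) t = c}.Countable := by
  filter_upwards [ae_lt_top' (hτ.aemeasurable_crossingCount hσ 1 c).enat_toENNReal
    (lintegral_crossingCount_deriv_lt_top hlam hσ hτ c).ne] with ω hω
  rw [ENat.toENNReal_lt_top] at hω
  exact (encard_lt_top_iff.1 hω).countable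

/-! ### Absence of multiple zeros of the derivative -/

/-- The first two derivatives encoded in `y` come simultaneously arbitrarily close to zero on
`[0, 1]`. -/
def RatMultipleZero (y : Option (ℕ × ℚ) → ℝ) : Prop :=
  ∀ n : ℕ, ∃ q : ℚ, 0 ≤ q ∧ q ≤ 1 ∧
    |(|y (some (1, q))| + |y (some (2, q))|)| < 1 / ((n : ℝ) + 1)

lemma measurableSet_ratMultipleZero : MeasurableSet {y | RatMultipleZero y} := by
  unfold RatMultipleZero
  simp only [measurableSet_setOfPred]
  refine Measurable.forall fun n => Measurable.exists fun q => ?_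
  refine Measurable.and measurable_const (Measurable.and measurable_const ?_)
  rw [← measurableSet_setOfPred]
  exact measurableSet_lt (by fun_prop) measurable_const

lemma ratMultipleZero_iff {z₁ z₂ : ℝ → ℝ} (h₁ : Continuous z₁) (h₂ : Continuous z₂)
    {y : Option (ℕ × ℚ) → ℝ} (hy₁ : ∀ q : ℚ, y (some (1, q)) = z₁ q)
    (hy₂ : ∀ q : ℚ, y (some (2, q)) = z₂ q) :
    RatMultipleZero y ↔ ∃ t ∈ Icc (0 : ℝ) 1, z₁ t = 0 ∧ z₂ t = 0 := by
  have key := exists_zero_Icc_iff_rat (r := fun t => |z₁ t| + |z₂ t|) (by fun_prop) 0 1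
  simp only [RatMultipleZero, hy₁, hy₂]
  rw [← key]
  push_cast
  refine exists_congr fun t => and_congr_right fun _ => ?_
  rw [add_eq_zero_iff_of_nonneg (abs_nonneg _) (abs_nonneg _), abs_eq_zero, abs_eq_zero]

/-- Almost surely the first two derivatives of the path have no common zero in `[0, 1]`. -/
theorem ae_no_multiple_zero [IsProbabilityMeasure μ] (hlam : 0 ≤ lam) (hσ : 0 < σ)
    (hτ : IsPoissonProcess μ lam τ) :
    ∀ᵐ ω ∂μ, ¬ ∃ t ∈ Icc (0 : ℝ) 1, pathDeriv σ 1 (fun i => τ i ω) t = 0 ∧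
      pathDeriv σ 2 (fun i => τ i ω) t = 0 := by
  classical
  set F : (Option (ℕ × ℚ) → ℝ) → ℝ≥0∞ := {y | RatMultipleZero y}.indicator 1 with hF
  have hFm : Measurable F := measurable_one.indicator measurableSet_ratMultipleZero
  -- Size bias converts this mean into an integral over the position of an added point; for almost
  -- every path, the tangential positions have measure zero.
  have hzero : ∀ R : ℕ, ∀ᵐ ω ∂μ,
      (natCount τ (Ico (-(R : ℝ)) R) ω : ℝ≥0∞) * F (linearStat (pathFamily σ R) τ ω) = 0 := by
    intro R
    have hdec := isDecayingFamily_pathFamily hσ R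
    have hYm := hτ.aemeasurable_linearStat hdec
    have hm : AEMeasurable (fun ω => (natCount τ (Ico (-(R : ℝ)) R) ω : ℝ≥0∞) *
        F (linearStat (pathFamily σ R) τ ω)) μ := by
      refine AEMeasurable.mul ?_ (hFm.comp_aemeasurable hYm)
      exact ((measurable_of_countable _).comp
        (hτ.measurable_natCount measurableSet_Ico)).aemeasurable
    refine (lintegral_eq_zero_iff' hm).1 ?_
    rw [hτ.lintegral_natCount_mul hlam hdec R hFm, lintegral_prod_symm]
    · refine mul_eq_zero_of_right _ ?_
      rw [lintegral_congr_ae (g := fun _ => 0), lintegral_zero]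
      filter_upwards [hτ.ae_summable,
        ae_countable_crossing_deriv hlam hσ hτ (-kernelDeriv σ 1 σ),
        ae_countable_crossing_deriv hlam hσ hτ (-kernelDeriv σ 1 (-σ))] with ω hω h1 h2
      have hnull := volume_tangential_eq_zero hσ (hasDerivAt_pathDeriv hσ hω 1) h1 h2
      rw [lintegral_congr_ae (g := fun _ => 0), lintegral_zero]
      refine ae_restrict_of_ae ?_
      filter_upwards [measure_eq_zero_iff_ae_notMem.1 hnull] with x hx
      rw [hF]
      refine indicator_of_notMem (fun hmem => hx ?_) _
      exact (ratMultipleZero_iff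
        (z₁ := fun t => pathDeriv σ 1 (fun i => τ i ω) t + kernelDeriv σ 1 (t - x))
        (z₂ := fun t => pathDeriv σ 2 (fun i => τ i ω) t + kernelDeriv σ 2 (t - x))
        ((continuous_pathDeriv hσ hω 1).add
          ((continuous_kernelDeriv 1).comp (continuous_id.sub continuous_const)))
        ((continuous_pathDeriv hσ hω 2).add
          ((continuous_kernelDeriv 2).comp (continuous_id.sub continuous_const)))
        (fun q => rfl) (fun q => rfl)).1 hmem
    · refine hFm.comp_aemeasurable ?_
      exact (hYm.comp_snd).add
        ((measurable_pi_lambda _ hdec.measurable).comp measurable_fst).aemeasurable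
  filter_upwards [hτ.ae_summable, ae_all_iff.2 hzero] with ω hω hall hex
  -- A window large enough to contain the point `τ 0 ω` has a nonzero count, so the vanishing
  -- product forces the indicator to vanish.
  obtain ⟨R, hR⟩ := exists_nat_gt |τ 0 ω|
  have hmem : τ 0 ω ∈ Ico (-(R : ℝ)) R :=
    ⟨by linarith [neg_abs_le (τ 0 ω)], by linarith [le_abs_self (τ 0 ω)]⟩
  have hfin := finite_mem_of_summable hω (Metric.isBounded_Ico (-(R : ℝ)) R)
  have hpos : natCount τ (Ico (-(R : ℝ)) R) ω ≠ 0 := by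
    rw [natCount, pointCount, hfin.encard_eq_coe_toFinset_card, ENat.toNat_natCast]
    exact Finset.card_ne_zero_of_mem (hfin.mem_toFinset.2 hmem)
  have hmz : RatMultipleZero (linearStat (pathFamily σ R) τ ω) :=
    (ratMultipleZero_iff (continuous_pathDeriv hσ hω 1) (continuous_pathDeriv hσ hω 2)
      (fun q => rfl) (fun q => rfl)).2 hex
  have h := hall R
  rw [hF, indicator_of_mem (show _ ∈ {y | RatMultipleZero y} from hmz), Pi.one_apply, mul_one] at h
  exact hpos (by exact_mod_cast h)

/-! ### Stationarity -/

lemma IsPoissonProcess.sub_const (hτ : IsPoissonProcess μ lam τ) (s : ℝ) :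
    IsPoissonProcess μ lam (fun i ω => τ i ω - s) where
  measurable_point i := (hτ.measurable_point i).sub_const s
  law_count B hB hBv := by
    have hv : volume ((fun y => y - s) ⁻¹' B) = volume B := 
      (measurePreserving_sub_right volume s).measure_preimage hB.nullMeasurableSet
    have := hτ.law_count ((fun y => y - s) ⁻¹' B) (measurable_id.sub_const s hB) (by rwa [hv])
    rw [Measure.real, hv] at this
    exact this
  indep_count n B hB hdis :=
    hτ.indep_count n (fun j => (fun y => y - s) ⁻¹' B j)
      (fun j => measurable_id.sub_const s (hB j)) (fun _ _ hjk => (hdis hjk).preimage _)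

lemma pathDeriv_sub_const (k : ℕ) (x : ℕ → ℝ) (s : ℝ) :
    pathDeriv σ k (fun i => x i - s) = fun t => pathDeriv σ k x (t + s) := by
  ext t
  unfold pathDeriv
  refine tsum_congr fun i => ?_
  congr 1
  ring

lemma crossingCount_comp_add (f : ℝ → ℝ) (c s : ℝ) :
    crossingCount (fun t => f (t + s)) c 0 1 = crossingCount f c s (s + 1) := by
  unfold crossingCount
  rw [← (add_left_injective s).encard_image]
  congr 1
  ext t
  simp only [mem_image, mem_ofPred_eq, mem_Icc]
  constructor
  · rintro ⟨u, ⟨⟨h1, h2⟩, h3⟩, rfl⟩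
    exact ⟨⟨by linarith, by linarith⟩, h3⟩
  · rintro ⟨⟨h1, h2⟩, h3⟩
    exact ⟨t - s, ⟨⟨by linarith, by linarith⟩, by simpa using h3⟩, by ring⟩

lemma lintegral_linearStat_sub_const [IsProbabilityMeasure μ] (hσ : 0 < σ)
    (hτ : IsPoissonProcess μ lam τ) (s : ℝ) {F : (Option (ℕ × ℚ) → ℝ) → ℝ≥0∞} (hF : Measurable F) :
    ∫⁻ ω, F (linearStat (pathFamily σ 0) (fun i ω => τ i ω - s) ω) ∂μ =
      ∫⁻ ω, F (linearStat (pathFamily σ 0) τ ω) ∂μ := by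
  have hdec := isDecayingFamily_pathFamily hσ 0
  rw [← lintegral_map' hF.aemeasurable ((hτ.sub_const s).aemeasurable_linearStat hdec),
    ← lintegral_map' hF.aemeasurable (hτ.aemeasurable_linearStat hdec),
    (hτ.sub_const s).map_linearStat_eq hτ hdec]

lemma aemeasurable_crossingCount_shift (hσ : 0 < σ) (hτ : IsPoissonProcess μ lam τ)
    (k : ℕ) (c s : ℝ) :
    AEMeasurable (fun ω => crossingCount (pathDeriv σ k (fun i => τ i ω)) c s (s + 1)) μ := by
  have := (hτ.sub_const s).aemeasurable_crossingCount hσ k c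
  simpa only [pathDeriv_sub_const, crossingCount_comp_add] using this

lemma lintegral_crossingCount_shift [IsProbabilityMeasure μ] (hσ : 0 < σ)
    (hτ : IsPoissonProcess μ lam τ) (k : ℕ) (c s : ℝ) :
    ∫⁻ ω, (crossingCount (pathDeriv σ k (fun i => τ i ω)) c s (s + 1) : ℝ≥0∞) ∂μ =
      ∫⁻ ω, (crossingCount (pathDeriv σ k (fun i => τ i ω)) c 0 1 : ℝ≥0∞) ∂μ := by
  have h := lintegral_linearStat_sub_const hσ hτ s (F := fun y =>
    (ratCount c (fun q => y (some (k, q))) : ℝ≥0∞))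
    (measurable_enat_iff.1 (measurable_ratCount_coord k c))
  have h1 : ∀ {τ : ℕ → Ω → ℝ}, IsPoissonProcess μ lam τ →
      ∫⁻ ω, (ratCount c (fun q => linearStat (pathFamily σ 0) τ ω (some (k, q))) : ℝ≥0∞) ∂μ =
      ∫⁻ ω, (crossingCount (pathDeriv σ k (fun i => τ i ω)) c 0 1 : ℝ≥0∞) ∂μ := by
    intro τ hτ
    refine lintegral_congr_ae ?_
    filter_upwards [hτ.ae_summable] with ω hω
    rw [ratCount_linearStat hσ hω]
  rw [h1 hτ, h1 (hτ.sub_const s)] at h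
  simpa only [pathDeriv_sub_const, crossingCount_comp_add] using h

/-- Translating the points by `s` turns evaluation at a real time into evaluation at the rational
time `0`. -/
lemma aemeasurable_pathDeriv_zero (hσ : 0 < σ) (hτ : IsPoissonProcess μ lam τ) (s : ℝ) :
    AEMeasurable (fun ω => pathDeriv σ 0 (fun i => τ i ω) s) μ := by
  have h := (measurable_pi_apply (some (0, (0 : ℚ)))).comp_aemeasurable
    ((hτ.sub_const s).aemeasurable_linearStat (isDecayingFamily_pathFamily hσ 0))
  refine h.congr (Filter.Eventually.of_forall fun ω => ?_)
  simp only [Function.comp_apply, linearStat_pathFamily_some, pathDeriv_sub_const, Rat.cast_zero,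
    zero_add]

lemma measure_level_shift [IsProbabilityMeasure μ] (hσ : 0 < σ) (hτ : IsPoissonProcess μ lam τ)
    (α s : ℝ) :
    μ {ω | pathDeriv σ 0 (fun i => τ i ω) s = α} = μ {ω | pathDeriv σ 0 (fun i => τ i ω) 0 = α} := by
  classical
  have hS : MeasurableSet {y : Option (ℕ × ℚ) → ℝ | y (some (0, 0)) = α} :=
    measurableSet_eq_fun (measurable_pi_apply _) measurable_const
  have h := lintegral_linearStat_sub_const hσ hτ s (measurable_one.indicator hS)
  have h1 : ∀ {τ : ℕ → Ω → ℝ}, IsPoissonProcess μ lam τ →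
      ∫⁻ ω, {y : Option (ℕ × ℚ) → ℝ | y (some (0, 0)) = α}.indicator 1
        (linearStat (pathFamily σ 0) τ ω) ∂μ =
      μ {ω | pathDeriv σ 0 (fun i => τ i ω) 0 = α} := by
    intro τ hτ
    rw [← lintegral_indicator_one₀]
    · refine lintegral_congr fun ω => ?_
      simp only [indicator_apply, mem_ofPred_eq, linearStat_pathFamily_some, Rat.cast_zero]
      rfl
    · exact (aemeasurable_pathDeriv_zero hσ hτ 0).nullMeasurable (measurableSet_singleton α)
  rw [h1 hτ, h1 (hτ.sub_const s)] at h
  simpa only [pathDeriv_sub_const, zero_add] using h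

/-! ### Comparison of the crossings of the path with those of its derivative -/

lemma lintegral_crossingCount_path_lt_top [IsProbabilityMeasure μ] (hlam : 0 ≤ lam) (hσ : 0 < σ)
    (hτ : IsPoissonProcess μ lam τ) (α : ℝ) :
    ∫⁻ ω, (crossingCount (pathDeriv σ 0 (fun i => τ i ω)) α 0 1 : ℝ≥0∞) ∂μ < ∞ := by
  calc ∫⁻ ω, (crossingCount (pathDeriv σ 0 (fun i => τ i ω)) α 0 1 : ℝ≥0∞) ∂μ
      ≤ ∫⁻ ω, ((crossingCount (pathDeriv σ 1 (fun i => τ i ω)) 0 0 1 : ℝ≥0∞) + 1) ∂μ := by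
        refine lintegral_mono_ae ?_
        filter_upwards [hτ.ae_summable] with ω hω
        have := crossingCount_le_crossingCount_deriv_add_one (hasDerivAt_pathDeriv hσ hω 0) α 0 1
        exact_mod_cast ENat.toENNReal_le.2 this
    _ = ∫⁻ ω, (crossingCount (pathDeriv σ 1 (fun i => τ i ω)) 0 0 1 : ℝ≥0∞) ∂μ + 1 := by
        rw [lintegral_add_right _ measurable_const]
        simp
    _ < ∞ := ENNReal.add_lt_top.2
        ⟨lintegral_crossingCount_deriv_lt_top hlam hσ hτ 0, ENNReal.one_lt_top⟩

/-- By stationarity the probability `e` does not depend on the time. The `m` times `j / m` in `[0,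
1]` contribute `m * e` to the mean number of crossings, which is finite, so `e = 0`. -/
lemma measure_level_eq_zero [IsProbabilityMeasure μ] (hlam : 0 ≤ lam) (hσ : 0 < σ)
    (hτ : IsPoissonProcess μ lam τ) (α s : ℝ) :
    μ {ω | pathDeriv σ 0 (fun i => τ i ω) s = α} = 0 := by
  classical
  rw [measure_level_shift hσ hτ]
  set e := μ {ω | pathDeriv σ 0 (fun i => τ i ω) 0 = α} with he
  set C := ∫⁻ ω, (crossingCount (pathDeriv σ 0 (fun i => τ i ω)) α 0 1 : ℝ≥0∞) ∂μ with hC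
  have hCtop : C < ∞ := lintegral_crossingCount_path_lt_top hlam hσ hτ α
  have hle : ∀ m : ℕ, (m : ℝ≥0∞) * e ≤ C := by
    intro m
    have hS : ∀ j : ℕ, NullMeasurableSet
        {ω | pathDeriv σ 0 (fun i => τ i ω) ((j : ℝ) / m) = α} μ := fun j =>
      (aemeasurable_pathDeriv_zero hσ hτ _).nullMeasurable (measurableSet_singleton α)
    calc (m : ℝ≥0∞) * e
        = ∑ j ∈ Finset.range m, μ {ω | pathDeriv σ 0 (fun i => τ i ω) ((j : ℝ) / m) = α} := by
          simp [measure_level_shift hσ hτ α (_ / _), he]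
      _ = ∑ j ∈ Finset.range m, ∫⁻ ω,
            {ω | pathDeriv σ 0 (fun i => τ i ω) ((j : ℝ) / m) = α}.indicator 1 ω ∂μ := by
          refine Finset.sum_congr rfl fun j _ => ?_
          rw [lintegral_indicator_one₀ (hS j)]
      _ = ∫⁻ ω, ∑ j ∈ Finset.range m,
            {ω | pathDeriv σ 0 (fun i => τ i ω) ((j : ℝ) / m) = α}.indicator 1 ω ∂μ :=
          (lintegral_finsetSum' _ fun j _ => aemeasurable_one.indicator₀ (hS j)).symm
      _ ≤ C := by
          refine lintegral_mono fun ω => ?_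
          have hinj : InjOn (fun j : ℕ => (j : ℝ) / m) (Finset.range m) := by
            intro i hi j _ hij
            have hm : (m : ℝ) ≠ 0 := by
              have := Finset.mem_range.1 hi
              exact_mod_cast (by omega : m ≠ 0)
            simpa [div_left_inj' hm] using hij
          set T := (Finset.range m).filter
            fun j : ℕ => pathDeriv σ 0 (fun i => τ i ω) ((j : ℝ) / m) = α with hT
          have hsum : ∑ j ∈ Finset.range m,
              {ω | pathDeriv σ 0 (fun i => τ i ω) ((j : ℝ) / m) = α}.indicator
                (1 : Ω → ℝ≥0∞) ω = T.card := by
            simp only [indicator_apply, mem_ofPred_eq, Pi.one_apply, Finset.sum_boole, hT]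
          have hcard : (T.card : ℕ∞) ≤ crossingCount (pathDeriv σ 0 (fun i => τ i ω)) α 0 1 := by
            rw [← encard_coe_eq_coe_finsetCard, ← InjOn.encard_image
              (hinj.mono (Finset.coe_subset.2 (hT ▸ Finset.filter_subset _ _)))]
            refine encard_le_encard ?_
            rintro t ⟨j, hj, rfl⟩
            obtain ⟨hj1, hj2⟩ := Finset.mem_filter.1 (Finset.mem_coe.1 hj)
            have hjm : (j : ℝ) < m := by exact_mod_cast Finset.mem_range.1 hj1
            refine ⟨⟨by positivity, ?_⟩, hj2⟩
            exact div_le_one_of_le₀ hjm.le (by positivity)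
          rw [hsum]
          have := ENat.toENNReal_le.2 hcard
          rwa [ENat.toENNReal_coe] at this
  by_contra hne
  have htop : Filter.Tendsto (fun m : ℕ => (m : ℝ≥0∞) * e) Filter.atTop (nhds (∞ * e)) :=
    ENNReal.Tendsto.mul_const ENNReal.tendsto_nat_nhds_top (Or.inl ENNReal.top_ne_zero)
  rw [ENNReal.top_mul hne] at htop
  exact absurd (le_of_tendsto' htop hle) (not_le.2 hCtop)

/-- Consecutive unit intervals share an integer endpoint; excluding crossings there avoids double
counting. -/
lemma sum_crossingCount_le {f : ℝ → ℝ} {α : ℝ} (hf : ∀ k : ℕ, f k ≠ α) (n : ℕ) :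
    ∑ k ∈ Finset.range n, crossingCount f α k (k + 1) ≤ crossingCount f α 0 n := by
  induction n with
  | zero => simp
  | succ n ih =>
    rw [Finset.sum_range_succ]
    refine (add_le_add_left ih _).trans ?_
    unfold crossingCount
    rw [← encard_union_eq]
    · refine encard_le_encard ?_
      have hn : (0 : ℝ) ≤ n := Nat.cast_nonneg n
      rintro t (⟨⟨h1, h2⟩, h3⟩ | ⟨⟨h1, h2⟩, h3⟩)
      · exact ⟨⟨h1, by push_cast; linarith⟩, h3⟩
      · exact ⟨⟨by linarith, by push_cast; linarith⟩, h3⟩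
    · refine disjoint_left.2 fun t h1 h2 => hf n ?_
      rw [le_antisymm h2.1.1 h1.1.2]
      exact h2.2

lemma crossingCount_le_sum (f : ℝ → ℝ) (c : ℝ) {n : ℕ} (hn : 1 ≤ n) :
    crossingCount f c 0 n ≤ ∑ k ∈ Finset.range n, crossingCount f c k (k + 1) := by
  induction n, hn using Nat.le_induction with
  | base => simp
  | succ n hn ih =>
    rw [Finset.sum_range_succ]
    refine le_trans ?_ (add_le_add_left ih _)
    unfold crossingCount
    refine le_trans (encard_le_encard ?_) (encard_union_le _ _)
    rintro t ⟨⟨h1, h2⟩, h3⟩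
    rcases le_total t n with h | h
    · exact Or.inl ⟨⟨h1, h⟩, h3⟩
    · exact Or.inr ⟨⟨h, by push_cast at h2; exact h2⟩, h3⟩

lemma toENNReal_finsetSum {κ : Type*} (s : Finset κ) (f : κ → ℕ∞) :
    ((∑ k ∈ s, f k : ℕ∞) : ℝ≥0∞) = ∑ k ∈ s, (f k : ℝ≥0∞) :=
  map_sum ENat.toENNRealRingHom _ _

/-- The mean number of crossings of a level by the path is at most the mean number of zeros of
its derivative. -/
theorem lintegral_crossingCount_path_le [IsProbabilityMeasure μ] (hlam : 0 ≤ lam) (hσ : 0 < σ)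
    (hτ : IsPoissonProcess μ lam τ) (α : ℝ) :
    ∫⁻ ω, (crossingCount (pathDeriv σ 0 (fun i => τ i ω)) α 0 1 : ℝ≥0∞) ∂μ ≤
      ∫⁻ ω, (crossingCount (pathDeriv σ 1 (fun i => τ i ω)) 0 0 1 : ℝ≥0∞) ∂μ := by
  set C := ∫⁻ ω, (crossingCount (pathDeriv σ 0 (fun i => τ i ω)) α 0 1 : ℝ≥0∞) ∂μ with hC
  set D := ∫⁻ ω, (crossingCount (pathDeriv σ 1 (fun i => τ i ω)) 0 0 1 : ℝ≥0∞) ∂μ with hD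
  have hCtop : C < ∞ := lintegral_crossingCount_path_lt_top hlam hσ hτ α
  have hDtop : D < ∞ := lintegral_crossingCount_deriv_lt_top hlam hσ hτ 0
  have hne : ∀ᵐ ω ∂μ, ∀ k : ℕ, pathDeriv σ 0 (fun i => τ i ω) k ≠ α :=
    ae_all_iff.2 fun k => measure_eq_zero_iff_ae_notMem.1 (measure_level_eq_zero hlam hσ hτ α k)
  have hsum : ∀ (j n : ℕ) (c : ℝ), ∫⁻ ω, ∑ k ∈ Finset.range n,
      (crossingCount (pathDeriv σ j (fun i => τ i ω)) c k (k + 1) : ℝ≥0∞) ∂μ =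
      n * ∫⁻ ω, (crossingCount (pathDeriv σ j (fun i => τ i ω)) c 0 1 : ℝ≥0∞) ∂μ := by
    intro j n c
    have hm : ∀ k ∈ Finset.range n, AEMeasurable (fun ω =>
        (crossingCount (pathDeriv σ j (fun i => τ i ω)) c k (k + 1) : ℝ≥0∞)) μ :=
      fun k _ => (aemeasurable_crossingCount_shift hσ hτ j c k).enat_toENNReal
    rw [lintegral_finsetSum' _ hm]
    simp only [lintegral_crossingCount_shift hσ hτ]
    simp
  -- Rolle is applied once on `[0, n]`, so the loss is `1` in total and not `1` per unit interval.
  -- It is negligible once `n > 1 / (C - D)`.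
  have hle : ∀ n : ℕ, 1 ≤ n → (n : ℝ≥0∞) * C ≤ n * D + 1 := by
    intro n hn
    rw [hC, ← hsum, hD, ← hsum]
    calc _ ≤ ∫⁻ ω, (∑ k ∈ Finset.range n,
          (crossingCount (pathDeriv σ 1 (fun i => τ i ω)) 0 k (k + 1) : ℝ≥0∞) + 1) ∂μ := by
          refine lintegral_mono_ae ?_
          filter_upwards [hτ.ae_summable, hne] with ω hω hω'
          have h := ((sum_crossingCount_le hω' n).trans (crossingCount_le_crossingCount_deriv_add_one
            (hasDerivAt_pathDeriv hσ hω 0) α 0 n)).trans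
            (add_le_add_left (crossingCount_le_sum _ 0 hn) 1)
          have h' := ENat.toENNReal_le.2 h
          rwa [ENat.toENNReal_add, toENNReal_finsetSum, toENNReal_finsetSum,
            ENat.toENNReal_one] at h'
      _ = _ := by
          rw [lintegral_add_right _ measurable_const]
          simp
  have hC' : C = ENNReal.ofReal C.toReal := (ENNReal.ofReal_toReal hCtop.ne).symm
  have hD' : D = ENNReal.ofReal D.toReal := (ENNReal.ofReal_toReal hDtop.ne).symm
  rw [hC', hD']
  refine ENNReal.ofReal_le_ofReal ?_
  by_contra hlt
  obtain ⟨n, hn⟩ := exists_nat_gt (1 / (C.toReal - D.toReal))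
  have hpos : 0 < C.toReal - D.toReal := by linarith [not_le.1 hlt]
  have hn1 : 1 ≤ n := by
    rcases Nat.eq_zero_or_pos n with rfl | h
    · have : 0 < 1 / (C.toReal - D.toReal) := by positivity
      simp only [Nat.cast_zero] at hn
      linarith
    · exact h
  have h := ENNReal.toReal_mono (ENNReal.add_ne_top.2
    ⟨ENNReal.mul_ne_top (ENNReal.natCast_ne_top n) hDtop.ne, ENNReal.one_ne_top⟩) (hle n hn1)
  rw [ENNReal.toReal_add (ENNReal.mul_ne_top (ENNReal.natCast_ne_top n) hDtop.ne)
    ENNReal.one_ne_top, ENNReal.toReal_mul, ENNReal.toReal_mul, ENNReal.toReal_natCast,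
    ENNReal.toReal_one] at h
  rw [div_lt_iff₀ hpos] at hn
  linarith

/-! ### Second derivative test and the final numerical bound -/

lemma isLocalExtr_iff_deriv_eq_zero {f : ℝ → ℝ} {t : ℝ} (hf : ContinuousAt f t)
    (h : ¬ (deriv f t = 0 ∧ deriv (deriv f) t = 0)) : IsLocalExtr f t ↔ deriv f t = 0 := by
  refine ⟨fun h => h.deriv_eq_zero, fun h0 => ?_⟩
  rcases lt_trichotomy (deriv (deriv f) t) 0 with hneg | hz | hpos
  · exact Or.inr (isLocalMax_of_deriv_deriv_neg hneg h0 hf)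
  · exact absurd ⟨h0, hz⟩ h
  · exact Or.inl (isLocalMin_of_deriv_deriv_pos hpos h0 hf)

/-- From `(1 - λ) e ^ λ ≤ 1` one gets `4 e ^ λ - 3 ≤ (1 + 3 λ) e ^ λ`, which is below the target.
Keeping `+ 3` on the left avoids truncated subtraction. -/
lemma le_bound_of_add_three_le (hlam : 0 ≤ lam) (hσ : 0 ≤ σ) {ρ : ℝ≥0∞}
    (h : ρ + 3 ≤ 4 * ENNReal.ofReal (Real.exp lam)) :
    ρ ≤ ENNReal.ofReal ((3 * lam * (2 + 2 * σ) + 1) * Real.exp lam) := by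
  have h1 : 4 * ENNReal.ofReal (Real.exp lam) = ENNReal.ofReal (4 * Real.exp lam) := by
    rw [ENNReal.ofReal_mul (by norm_num)]
    norm_num
  have h2 : ENNReal.ofReal ((3 * lam * (2 + 2 * σ) + 1) * Real.exp lam) + 3 =
      ENNReal.ofReal ((3 * lam * (2 + 2 * σ) + 1) * Real.exp lam + 3) := by
    rw [ENNReal.ofReal_add (by positivity) (by norm_num)]
    norm_num
  refine (ENNReal.add_le_add_iff_right (a := 3) (by simp)).1 ?_
  rw [h2]
  refine h.trans (h1.le.trans (ENNReal.ofReal_le_ofReal ?_))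
  have hexp : (1 - lam) * Real.exp lam ≤ 1 := by
    have := Real.one_sub_le_exp_neg lam
    calc (1 - lam) * Real.exp lam ≤ Real.exp (-lam) * Real.exp lam := by gcongr
      _ = 1 := by rw [← Real.exp_add]; simp
  have hpos := Real.exp_pos lam
  have : 0 ≤ lam * σ * Real.exp lam := by positivity
  have : 0 ≤ lam * Real.exp lam := by positivity
  nlinarith

end ShotNoise

end

/-! ### The main theorem -/

theorem proposition9 {Ω : Type*} [MeasurableSpace Ω] (μ : Measure Ω) [IsProbabilityMeasure μ]
    (lam σ : ℝ) (hlam : 0 < lam) (hσ : 0 < σ) (τ : ℕ → Ω → ℝ)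
    (hτ : ShotNoise.IsPoissonProcess μ lam τ) :
    -- the series converges and defines a twice continuously differentiable path, almost surely
    (∀ᵐ ω ∂μ, (∀ t : ℝ, Summable fun i => ShotNoise.gaussianKernel σ (t - τ i ω)) ∧
      ContDiff ℝ 2 (ShotNoise.shotNoise σ τ ω)) ∧
    -- the counting variables are random variables, up to null sets
    (∀ α : ℝ, AEMeasurable
      (fun ω => ShotNoise.crossingCount (ShotNoise.shotNoise σ τ ω) α 0 1) μ) ∧
    AEMeasurable
      (fun ω => ShotNoise.crossingCount (deriv (ShotNoise.shotNoise σ τ ω)) 0 0 1) μ ∧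
    AEMeasurable (fun ω => ShotNoise.localExtrCount (ShotNoise.shotNoise σ τ ω) 0 1) μ ∧
    -- the first two derivatives have almost surely no common zero in `[0, 1]`
    μ {ω | ∃ t ∈ Icc (0 : ℝ) 1, deriv (ShotNoise.shotNoise σ τ ω) t = 0 ∧
      deriv (deriv (ShotNoise.shotNoise σ τ ω)) t = 0} = 0 ∧
    -- the local extrema in `[0, 1]` are almost surely exactly the zeros of the derivative
    (∀ᵐ ω ∂μ, ∀ t ∈ Icc (0 : ℝ) 1, IsLocalExtr (ShotNoise.shotNoise σ τ ω) t ↔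
      deriv (ShotNoise.shotNoise σ τ ω) t = 0) ∧
    ShotNoise.meanLocalExtr μ (ShotNoise.shotNoise σ τ) 0 1 =
      ShotNoise.meanCrossings μ (fun ω => deriv (ShotNoise.shotNoise σ τ ω)) 0 0 1 ∧
    (∀ α : ℝ, ShotNoise.meanCrossings μ (ShotNoise.shotNoise σ τ) α 0 1 ≤
      ShotNoise.meanLocalExtr μ (ShotNoise.shotNoise σ τ) 0 1) ∧
    ShotNoise.meanLocalExtr μ (ShotNoise.shotNoise σ τ) 0 1 ≤
      ENNReal.ofReal ((3 * lam * (2 + 2 * σ) + 1) * Real.exp lam) := by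
  have hlam' := hlam.le
  have hpath : ∀ᵐ ω ∂μ, ShotNoise.shotNoise σ τ ω = ShotNoise.pathDeriv σ 0 (fun i => τ i ω) ∧
      deriv (ShotNoise.shotNoise σ τ ω) = ShotNoise.pathDeriv σ 1 (fun i => τ i ω) ∧
      deriv (deriv (ShotNoise.shotNoise σ τ ω)) = ShotNoise.pathDeriv σ 2 (fun i => τ i ω) := by
    filter_upwards [hτ.ae_summable] with ω hω
    rw [ShotNoise.shotNoise_eq_pathDeriv, ShotNoise.deriv_pathDeriv hσ hω,
      ShotNoise.deriv_pathDeriv hσ hω]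
    exact ⟨rfl, rfl, rfl⟩
  have hmult : ∀ᵐ ω ∂μ, ¬ ∃ t ∈ Icc (0 : ℝ) 1, deriv (ShotNoise.shotNoise σ τ ω) t = 0 ∧
      deriv (deriv (ShotNoise.shotNoise σ τ ω)) t = 0 := by
    filter_upwards [hpath, ShotNoise.ae_no_multiple_zero hlam' hσ hτ] with ω hω h
    rwa [hω.2.2, hω.2.1]
  have hextr : ∀ᵐ ω ∂μ, ∀ t ∈ Icc (0 : ℝ) 1, IsLocalExtr (ShotNoise.shotNoise σ τ ω) t ↔
      deriv (ShotNoise.shotNoise σ τ ω) t = 0 := by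
    filter_upwards [hτ.ae_summable, hmult] with ω hω h t ht
    refine ShotNoise.isLocalExtr_iff_deriv_eq_zero ?_ fun h0 => h ⟨t, ht, h0⟩
    rw [ShotNoise.shotNoise_eq_pathDeriv]
    exact (ShotNoise.continuous_pathDeriv hσ hω 0).continuousAt
  have hcount : ∀ᵐ ω ∂μ, ShotNoise.localExtrCount (ShotNoise.shotNoise σ τ ω) 0 1 =
      ShotNoise.crossingCount (deriv (ShotNoise.shotNoise σ τ ω)) 0 0 1 := by
    filter_upwards [hextr] with ω h
    unfold ShotNoise.localExtrCount ShotNoise.crossingCount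
    congr 1
    ext t
    exact and_congr_right (h t)
  have hderiv : AEMeasurable
      (fun ω => ShotNoise.crossingCount (deriv (ShotNoise.shotNoise σ τ ω)) 0 0 1) μ := by
    refine (hτ.aemeasurable_crossingCount hσ 1 0).congr ?_
    filter_upwards [hpath] with ω hω
    rw [hω.2.1]
  have hmean : ShotNoise.meanLocalExtr μ (ShotNoise.shotNoise σ τ) 0 1 =
      ∫⁻ ω, (ShotNoise.crossingCount (ShotNoise.pathDeriv σ 1 (fun i => τ i ω)) 0 0 1 : ℝ≥0∞) ∂μ := by
    refine lintegral_congr_ae ?_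
    filter_upwards [hpath, hcount] with ω hω h
    rw [h, hω.2.1]
  refine ⟨?_, fun α => ?_, hderiv, hderiv.congr ?_, ?_, hextr, ?_, fun α => ?_, ?_⟩
  · filter_upwards [hτ.ae_summable] with ω hω
    refine ⟨fun t => ?_, ?_⟩
    · simpa only [ShotNoise.kernelDeriv_zero] using ShotNoise.summable_kernelDeriv hσ hω 0 t
    · rw [ShotNoise.shotNoise_eq_pathDeriv]
      exact ShotNoise.contDiff_pathDeriv hσ hω 2 0
  · simpa only [ShotNoise.shotNoise_eq_pathDeriv] using hτ.aemeasurable_crossingCount hσ 0 α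
  · filter_upwards [hcount] with ω h using h.symm
  · exact measure_eq_zero_iff_ae_notMem.2 hmult
  · refine lintegral_congr_ae ?_
    filter_upwards [hcount] with ω h
    rw [h]
  · rw [hmean]
    simpa only [ShotNoise.meanCrossings, ShotNoise.shotNoise_eq_pathDeriv] using
      ShotNoise.lintegral_crossingCount_path_le hlam' hσ hτ α
  · rw [hmean]
    exact ShotNoise.le_bound_of_add_three_le hlam' hσ.le
      (ShotNoise.lintegral_crossingCount_deriv_add_le hlam' hσ hτ 0)
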